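/- Let $g\in S_2(\Gamma_0(N))$ be a (normalized, elliptic) newform with Fourier coefficients $a_n(g)$, let $p\ge 5$ be a prime with $p\nmid N$, and let $\lambda$ be the prime above $p$ of the Hecke field $\mathbb{Q}(a_n(g):n\ge 1)$ induced by an embedding of this field into $\overline{\mathbb{Q}}_p$. Let $V_g$ be the associated two-dimensional $\lambda$-adic representation of $G_{\mathbb{Q}}=\mathrm{Gal}(\overline{\mathbb{Q}}/\mathbb{Q})$, viewed over $\overline{\mathbb{Q}}_p$: it is continuous, unramified at every prime $\ell\nmid Np$, and there an arithmetic Frobenius has characteristic polynomial $X^2-a_\ell(g)X+\ell$. Let $\bar\rho_g:G_{\mathbb{Q}}\to \mathrm{GL}_2(\overline{\mathbb{F}}_p)$ be the reduction of a $G_{\mathbb{Q}}$-stable lattice $T_g\subset V_g$. Assume that $g$ is ordinary at $p$, i.e. there is a line $\mathrm{Fil}^+(V_g)\subset V_g$, stable under a decomposition group at $p$, on which the inertia group acts by the $p$-adic cyclotomic character and such that inertia acts trivially on $V_g/\mathrm{Fil}^+(V_g)$ (equivalently, $a_p(g)$ is a unit at $\lambda$). Assume also that $\bar\rho_g$ is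 irreducible as a representation of $G_{\mathbb{Q}}$. For a number field $L\subset\overline{\mathbb{Q}}$ write $D_L$ for its discriminant and $G_L=\mathrm{Gal}(\overline{\mathbb{Q}}/L)$. Then there exist an imaginary quadratic field $K\subset\overline{\mathbb{Q}}$ and a real quadratic field $F\subset\overline{\mathbb{Q}}$ such that $K$ satisfies - (disc) $D_K$ is odd and $D_K\ne -3$; - (Heeg) every prime $\ell\mid N$ splits in $K$; - (spl) $p$ splits in $K$; - (irr$_K$) $\bar\rho_g|_{G_K}$ is irreducible; and $F$ satisfies - (i) $p$ is inert in $F$; - (ii) $D_F$ is odd and every prime dividing $D_F$ splits in $K$; - (iii) every prime $\ell\mid N$ is inert in $F$ if $\ell\equiv -1 \pmod p$, and is split in $F$ otherwise; - (iv) $\bar\rho_g|_{G_{FK}}$ is irreducible; - (v) $\bar\rho_g|_{G_{F(\zeta_p)}}$ is irreducible, where $\zeta_p$ is a primitive $p$-th root of unity; - (vi) if $p=5$, then $F\ne\mathbb{Q}(\zeta_5)^+$. -/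

import Mathlib

open scoped MatrixGroups Pointwise NumberField Modular NNReal

noncomputable section

namespace NewformFields

/-! ### Newforms of weight two on `Γ₀(N)` -/

/-- The group `Γ₀(N)`, as a subgroup of `GL₂(ℝ)`. -/
abbrev G0 (N : ℕ) : Subgroup (GL (Fin 2) ℝ) := (CongruenceSubgroup.Gamma0 N : Subgroup (GL (Fin 2) ℝ))

/-- The `n`-th Fourier coefficient `aₙ(g)` at the cusp `∞`, so that `g = ∑ aₙ(g) qⁿ`, `q = e^{2πiτ}`. -/
def fourierCoeff {N : ℕ} (g : CuspForm (G0 N) 2) (n : ℕ) : ℂ :=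
  (UpperHalfPlane.qExpansion 1 g).coeff n

/-- The Hecke operator of weight two and level `Γ₀(N)` at a prime `ℓ` (usually written `T_ℓ` when
`ℓ ∤ N` and `U_ℓ` when `ℓ ∣ N`):
`(T_ℓ f)(τ) = ℓ⁻¹ ∑_{0 ≤ j < ℓ} f((τ + j)/ℓ) + 𝟏_{ℓ ∤ N} ℓ f(ℓτ)`. -/
def heckeOp (N ℓ : ℕ) (f : UpperHalfPlane → ℂ) (τ : UpperHalfPlane) : ℂ :=
  (ℓ : ℂ)⁻¹ * ∑ j ∈ Finset.range ℓ, f (UpperHalfPlane.ofComplex (((τ : ℂ) + j) / ℓ)) +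
    if ℓ ∣ N then 0 else (ℓ : ℂ) * f (UpperHalfPlane.ofComplex ((ℓ : ℂ) * τ))

/-- The (unnormalised) Petersson product of two functions that are modular of weight two for
`Γ₀(N)`: the integral of `conj (f τ) * h τ * (im τ) ^ 2` with respect to `dx dy / y²` over the
fundamental domain of `Γ₀(N)` made of the translates of the standard fundamental domain `𝒟` of
`SL₂(ℤ)` by representatives of `Γ₀(N) \ SL₂(ℤ)`. -/
def peterssonProduct (N : ℕ) (f h : UpperHalfPlane → ℂ) : ℂ :=
  ∑ᶠ c : SL(2, ℤ) ⧸ CongruenceSubgroup.Gamma0 N,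
    ∫ τ in 𝒟, UpperHalfPlane.petersson 2 f h (c.out⁻¹ • τ)

/-- `g ∈ S₂(Γ₀(N))` is a newform: it is normalised, an eigenform of all Hecke operators, and
orthogonal to the old subspace, which is spanned by the forms `τ ↦ h(dτ)` with
`h ∈ S₂(Γ₀(M))`, `M` a proper divisor of `N` and `d ∣ N / M`. -/
structure IsNewform {N : ℕ} (g : CuspForm (G0 N) 2) : Prop where
  normalised : fourierCoeff g 1 = 1
  eigenform : ∀ ℓ : ℕ, ℓ.Prime → ∃ c : ℂ, ∀ τ, heckeOp N ℓ g τ = c * g τ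
  new : ∀ M d : ℕ, M * d ∣ N → M ≠ N → ∀ h : CuspForm (G0 M) 2,
    peterssonProduct N (fun τ ↦ h (UpperHalfPlane.ofComplex ((d : ℂ) * τ))) g = 0

/-- The Hecke field `ℚ(aₙ(g) : n)` of `g`. -/
abbrev heckeField {N : ℕ} (g : CuspForm (G0 N) 2) : IntermediateField ℚ ℂ :=
  IntermediateField.adjoin ℚ (Set.range (fourierCoeff g))

/-- The Fourier coefficients as elements of the Hecke field. -/
def heckeCoeff {N : ℕ} (g : CuspForm (G0 N) 2) (n : ℕ) : heckeField g :=
  ⟨fourierCoeff g n, IntermediateField.subset_adjoin _ _ ⟨n, rfl⟩⟩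

/-! ### Galois representations -/

/-- An algebraic closure of `ℚ`. -/
abbrev QBar : Type := AlgebraicClosure ℚ

/-- The absolute Galois group of `ℚ`, with its Krull topology. -/
abbrev GQ : Type := QBar ≃ₐ[ℚ] QBar

/-- The ring of integers of the algebraic closure of `ℚ_p`; its residue field is an algebraic
closure of `𝔽_p`. -/
abbrev ZBar (p : ℕ) [Fact p.Prime] : ValuationSubring (PadicAlgCl p) :=
  (Valued.v : Valuation (PadicAlgCl p) ℝ≥0).valuationSubring

/-- The residue field of `ZBar p`, an algebraic closure of `𝔽_p`. -/
abbrev FBar (p : ℕ) [Fact p.Prime] : Type := IsLocalRing.ResidueField (ZBar p)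

/-- The prime ideal `𝔓` of the ring of all algebraic integers lies above the prime number `ℓ`. -/
def LiesAbove (𝔓 : Ideal (𝓞 QBar)) (ℓ : ℕ) : Prop := 𝔓.IsPrime ∧ (ℓ : 𝓞 QBar) ∈ 𝔓

/-- Let `λ` be the prime above `p` of the Hecke field of `g` that is induced by the embedding `ι`.
`IsGaloisRepOf g ι ρ` says that `ρ`, viewed over the algebraic closure of `ℚ_p`, is the
`λ`-adic Galois representation `V_g` of `g`, written in a basis of a Galois stable lattice `T_g`:
it is continuous, unramified outside `Np`, and for all primes `ℓ ∤ Np` the characteristic polynomial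
of an arithmetic Frobenius at `ℓ` is `X² - a_ℓ(g) X + ℓ`. -/
structure IsGaloisRepOf {N p : ℕ} [Fact p.Prime] (g : CuspForm (G0 N) 2)
    (ι : heckeField g →+* PadicAlgCl p) (ρ : GQ →* GL (Fin 2) (ZBar p)) : Prop where
  continuous : Continuous ρ
  unramified : ∀ ℓ : ℕ, ℓ.Prime → ¬ ℓ ∣ N * p → ∀ 𝔓 : Ideal (𝓞 QBar), LiesAbove 𝔓 ℓ →
    ∀ σ ∈ 𝔓.inertia GQ, ρ σ = 1
  frobenius : ∀ ℓ : ℕ, ℓ.Prime → ¬ ℓ ∣ N * p → ∀ 𝔓 : Ideal (𝓞 QBar), LiesAbove 𝔓 ℓ →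
    ∀ σ : GQ, IsArithFrobAt ℤ σ 𝔓 →
      (((ρ σ : Matrix (Fin 2) (Fin 2) (ZBar p)).trace : ZBar p) : PadicAlgCl p)
        = ι (heckeCoeff g ℓ) ∧
      (((ρ σ : Matrix (Fin 2) (Fin 2) (ZBar p)).det : ZBar p) : PadicAlgCl p) = (ℓ : PadicAlgCl p)

/-- The action of `ρ σ` on the vector space `V = (PadicAlgCl p)²`. -/
def act {p : ℕ} [Fact p.Prime] (ρ : GQ →* GL (Fin 2) (ZBar p)) (σ : GQ)
    (v : Fin 2 → PadicAlgCl p) : Fin 2 → PadicAlgCl p :=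
  ((ρ σ : Matrix (Fin 2) (Fin 2) (ZBar p)).map (ZBar p).subtype).mulVec v

/-- The `p`-adic cyclotomic character of `G_ℚ`, with values in the algebraic closure of `ℚ_p`. -/
def cyclo (p : ℕ) [Fact p.Prime] (σ : GQ) : PadicAlgCl p :=
  algebraMap ℚ_[p] (PadicAlgCl p) ((cyclotomicCharacter QBar p σ.toRingEquiv : ℤ_[p]) : ℚ_[p])

/-- The representation is ordinary at `p` (with Hodge-Tate weights as in weight two): at a place
`𝔓` of `QBar` above `p` there is a line `Fil⁺ ⊂ V`, stable under the decomposition group, such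
that inertia acts on `Fil⁺` through the cyclotomic character and trivially on `V / Fil⁺`. All
places above `p` are conjugate, so that the choice of `𝔓` is immaterial. -/
def IsOrdinary {p : ℕ} [Fact p.Prime] (ρ : GQ →* GL (Fin 2) (ZBar p)) : Prop :=
  ∃ 𝔓 : Ideal (𝓞 QBar), LiesAbove 𝔓 p ∧
    ∃ Fil : Submodule (PadicAlgCl p) (Fin 2 → PadicAlgCl p),
      Module.finrank (PadicAlgCl p) Fil = 1 ∧
      (∀ σ ∈ MulAction.stabilizer GQ 𝔓, ∀ v ∈ Fil, act ρ σ v ∈ Fil) ∧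
      (∀ σ ∈ 𝔓.inertia GQ, ∀ v ∈ Fil, act ρ σ v = cyclo p σ • v) ∧
      (∀ σ ∈ 𝔓.inertia GQ, ∀ v, act ρ σ v - v ∈ Fil)

/-- The residual representation, with values in `GL₂` of an algebraic closure of `𝔽_p`. -/
def residual {p : ℕ} [Fact p.Prime] (ρ : GQ →* GL (Fin 2) (ZBar p)) : GQ →* GL (Fin 2) (FBar p) :=
  (Matrix.GeneralLinearGroup.map (IsLocalRing.residue (ZBar p))).comp ρ

/-- The restriction of `r` to the absolute Galois group `G_L` of a subfield `L` of `QBar`, as a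
representation on `k²`. -/
def restrictRep {k : Type*} [Field k] (r : GQ →* GL (Fin 2) k) (L : IntermediateField ℚ QBar) :
    Representation k L.fixingSubgroup (Fin 2 → k) :=
  ((Matrix.toLinAlgEquiv' : Matrix (Fin 2) (Fin 2) k ≃ₐ[k] _) :
      Matrix (Fin 2) (Fin 2) k →* ((Fin 2 → k) →ₗ[k] (Fin 2 → k))).comp
    ((Units.coeHom _).comp (r.comp L.fixingSubgroup.subtype))

/-- `r` is irreducible as a representation of `G_L`. -/
def IrreducibleOver {k : Type*} [Field k] (r : GQ →* GL (Fin 2) k)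
    (L : IntermediateField ℚ QBar) : Prop :=
  (restrictRep r L).IsIrreducible

/-! ### Quadratic fields -/

/-- The number `ℓ` splits in the quadratic field `K`: `(ℓ) = v w` with distinct primes `v`, `w`. -/
def SplitsIn (ℓ : ℕ) (K : Type*) [Field K] : Prop :=
  ∃ v w : Ideal (𝓞 K), v.IsPrime ∧ w.IsPrime ∧ v ≠ w ∧ Ideal.span {(ℓ : 𝓞 K)} = v * w

/-- The number `ℓ` is inert in `K`: it generates a prime ideal. -/
def InertIn (ℓ : ℕ) (K : Type*) [Field K] : Prop :=
  (Ideal.span {(ℓ : 𝓞 K)}).IsPrime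

/-- `K` is an imaginary quadratic field. -/
def IsImaginaryQuadratic (K : Type*) [Field K] [NumberField K] : Prop :=
  Module.finrank ℚ K = 2 ∧ NumberField.IsTotallyComplex K

/-- `F` is a real quadratic field. -/
def IsRealQuadratic (F : Type*) [Field F] [NumberField F] : Prop :=
  Module.finrank ℚ F = 2 ∧ NumberField.IsTotallyReal F

/-- The cyclotomic field `ℚ(ζ_n)` inside `QBar`. -/
def cyclotomicSubfield (n : ℕ) : IntermediateField ℚ QBar :=
  IntermediateField.adjoin ℚ {ζ | IsPrimitiveRoot ζ n}

/-- The maximal real subfield `ℚ(ζ_n)⁺ = ℚ(ζ_n + ζ_n⁻¹)` inside `QBar`. -/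
def realCyclotomicSubfield (n : ℕ) : IntermediateField ℚ QBar :=
  IntermediateField.adjoin ℚ {x | ∃ ζ, IsPrimitiveRoot ζ n ∧ x = ζ + ζ⁻¹}

/-- The conditions on the imaginary quadratic field `K`. -/
structure ConditionsOnK (N p : ℕ) [Fact p.Prime] (ρbar : GQ →* GL (Fin 2) (FBar p))
    (K : IntermediateField ℚ QBar) [NumberField K] : Prop where
  imaginaryQuadratic : IsImaginaryQuadratic K
  disc : Odd (NumberField.discr K) ∧ NumberField.discr K ≠ -3
  heeg : ∀ ℓ : ℕ, ℓ.Prime → ℓ ∣ N → SplitsIn ℓ K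
  spl : SplitsIn p K
  irr : IrreducibleOver ρbar K

/-- The conditions on the real quadratic field `F`, for a given imaginary quadratic field `K`. -/
structure ConditionsOnF (N p : ℕ) [Fact p.Prime] (ρbar : GQ →* GL (Fin 2) (FBar p))
    (K F : IntermediateField ℚ QBar) [NumberField K] [NumberField F] : Prop where
  realQuadratic : IsRealQuadratic F
  inert_p : InertIn p F
  disc_odd : Odd (NumberField.discr F)
  disc_split : ∀ ℓ : ℕ, ℓ.Prime → (ℓ : ℤ) ∣ NumberField.discr F → SplitsIn ℓ K
  inert_level : ∀ ℓ : ℕ, ℓ.Prime → ℓ ∣ N → (ℓ : ℤ) ≡ -1 [ZMOD p] → InertIn ℓ F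
  split_level : ∀ ℓ : ℕ, ℓ.Prime → ℓ ∣ N → ¬ (ℓ : ℤ) ≡ -1 [ZMOD p] → SplitsIn ℓ F
  irr_compositum : IrreducibleOver ρbar (F ⊔ K)
  irr_cyclotomic : IrreducibleOver ρbar (F ⊔ cyclotomicSubfield p)
  ne_real_cyclotomic : p = 5 → F ≠ realCyclotomicSubfield 5

end NewformFields

end

open scoped MatrixGroups Pointwise NumberField Modular NNReal

noncomputable section

namespace NewformFields

/-! ### Irreducibility as absence of stable subspaces -/

section Residual

variable {k : Type*} [Field k] (r : GQ →* GL (Fin 2) k)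

/-! Take `K = ℚ(√-q)` and `F = ℚ(√r)` for primes `q`, `r` supplied by Dirichlet's theorem. With `q ≡
-1` modulo `8Np`, the number `-q` is `1` modulo `8Np`, so `p` and every prime dividing `N` split in
`K`. The prime `r` is `1` modulo `8`, a nonresidue modulo `p` and modulo the odd `ℓ ∣ N` with `ℓ ≡
-1 mod p`, and `1` modulo the other odd primes dividing `Npq`. As `r ≡ 1` modulo both `4` and `q`,
reciprocity makes `-q` a square modulo `r`, so `r` splits in `K`.

Irreducibility over a quadratic extension comes from ramification (`IrreducibleOver.sup_quadratic`).
If `q` ramifies in the quadratic field but neither in `L` nor in the representation, then inertia at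
`q` contains an element moving the quadratic field, fixing `L` and lying in the kernel. Hence
passing to the compositum does not change the image of `G_L`. This is applied to `K` over `ℚ`, to
`F` over `K`, and to `F` over `ℚ(ζ_p)`.

Irreducibility over `ℚ(ζ_p)` itself uses ordinarity (`IrreducibleOver.of_generator`). Inertia at `p`
contains a generator `σ` of `Gal(ℚ(ζ_p)/ℚ)`, on which the residual representation satisfies `(X -
w)(X - 1) = 0` with `w` the cyclotomic character modulo `p`; and `w ≠ -1` because a generator has
order `p - 1 > 2`. A line stable under `G_{ℚ(ζ_p)}` and moved by `σ` then has three distinct stable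
translates, so `G_{ℚ(ζ_p)}` acts by scalars, and an eigenline of `σ` would be stable under all of
`G_ℚ`. -/

theorem irreducibleOver_iff (L : IntermediateField ℚ QBar) :
    IrreducibleOver r L ↔ ∀ W : Submodule k (Fin 2 → k),
      (∀ σ ∈ L.fixingSubgroup, ∀ v ∈ W, (r σ : Matrix (Fin 2) (Fin 2) k).mulVec v ∈ W) →
      W = ⊥ ∨ W = ⊤ := by
  constructor
  · intro h W hW
    have : IsSimpleOrder (Subrepresentation (restrictRep r L)) := h
    rcases eq_bot_or_eq_top (⟨W, fun g v hv ↦ hW g.1 g.2 v hv⟩ :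
      Subrepresentation (restrictRep r L)) with h | h
    · exact .inl (congrArg Subrepresentation.toSubmodule h)
    · exact .inr (congrArg Subrepresentation.toSubmodule h)
  · intro h
    refine @IsSimpleOrder.mk _ _ _ ⟨⟨⊥, ⊤, fun h ↦ ?_⟩⟩ fun W ↦ ?_
    · exact bot_ne_top (α := Submodule k (Fin 2 → k))
        (congrArg Subrepresentation.toSubmodule h)
    · rcases h W.toSubmodule fun σ hσ v hv ↦ W.apply_mem_toSubmodule ⟨σ, hσ⟩ hv with h | h
      · exact .inl (Subrepresentation.toSubmodule_injective h)
      · exact .inr (Subrepresentation.toSubmodule_injective h)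

/-- Irreducibility descends to an index two subgroup that misses an element of the kernel. -/
theorem IrreducibleOver.of_index_two {L M : IntermediateField ℚ QBar}
    (h : IrreducibleOver r L) {τ : GQ} (hτ : r τ = 1)
    (hM : ∀ σ ∈ L.fixingSubgroup, σ ∈ M.fixingSubgroup ∨ τ * σ ∈ M.fixingSubgroup) :
    IrreducibleOver r M := by
  rw [irreducibleOver_iff] at h ⊢
  intro W hW
  refine h W fun σ hσ v hv ↦ ?_
  rcases hM σ hσ with h | h
  · exact hW σ h v hv
  · simpa [hτ] using hW _ h v hv

end Residual

/-! ### Inertia groups in the absolute Galois group -/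

section Inertia

instance : IsAlgClosure ℚ QBar := by
  have h : (DivisionRing.toRatAlgebra : Algebra ℚ QBar) = AlgebraicClosure.instAlgebra ℚ :=
    Subsingleton.elim _ _
  rw [h]
  infer_instance

instance : Algebra.IsAlgebraic ℚ QBar := IsAlgClosure.isAlgebraic

instance : IsGalois ℚ QBar where
  to_normal := IsAlgClosure.normal ℚ QBar

@[simp]
theorem coe_smul_integer (σ : GQ) (x : 𝓞 QBar) : ((σ • x : 𝓞 QBar) : QBar) = σ x := rfl

theorem continuousSMul_integers [TopologicalSpace (𝓞 QBar)] [DiscreteTopology (𝓞 QBar)] :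
    ContinuousSMul GQ (𝓞 QBar) := by
  rw [continuousSMul_iff_stabilizer_isOpen]
  intro x
  convert stabilizer_isOpen_of_isIntegral (K := ℚ) (x : QBar) using 1
  ext σ
  exact (NumberField.RingOfIntegers.ext_iff (x := σ • x) (y := x))

/-- If `𝔓` is totally ramified over the subfield `L`, then inertia surjects onto the Galois group
of `L`. -/
theorem exists_mul_mem_inertia (𝔓 : Ideal (𝓞 QBar)) [𝔓.IsPrime] (L : IntermediateField ℚ QBar)
    (h : ∀ (σ : GQ) (x : 𝓞 QBar), (x : QBar) ∈ L → σ • x - x ∈ 𝔓) (σ : GQ) :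
    ∃ τ ∈ L.fixingSubgroup, τ * σ ∈ 𝔓.inertia GQ := by
  let H := L.fixingSubgroup
  have : CompactSpace H := isCompact_iff_compactSpace.mp
    (InfiniteGalois.fixingSubgroup_isClosed L).isCompact
  -- With the discrete topology the action of the profinite group `H` is continuous, so the
  -- transitivity and decomposition theorems for profinite groups apply.
  let : TopologicalSpace (𝓞 QBar) := ⊥
  have : DiscreteTopology (𝓞 QBar) := ⟨rfl⟩
  have := continuousSMul_integers
  have : ContinuousSMul H (𝓞 QBar) := ⟨by
    have : Continuous fun p : H × 𝓞 QBar ↦ (p.1 : GQ) • p.2 := by fun_prop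
    exact this⟩
  have : TotallyDisconnectedSpace GQ :=
    @TotallySeparatedSpace.totallyDisconnectedSpace _ _ ⟨krullTopology_isTotallySeparated⟩
  have : TotallyDisconnectedSpace H := inferInstance
  let A := FixedPoints.subalgebra ℤ (𝓞 QBar) H
  have : Algebra.IsInvariant A (𝓞 QBar) H := ⟨fun b hb ↦ ⟨⟨b, hb⟩, rfl⟩⟩
  have hA : ∀ x : A, ((x : 𝓞 QBar) : QBar) ∈ L := by
    intro x
    rw [← InfiniteGalois.fixedField_fixingSubgroup L]
    intro τ
    exact congrArg (fun y : 𝓞 QBar ↦ (y : QBar)) (x.2 τ)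
  have hA' : ∀ (σ : GQ) (x : A), σ • (x : 𝓞 QBar) ∈ 𝔓 ↔ (x : 𝓞 QBar) ∈ 𝔓 := by
    intro σ x
    have := h σ x (hA x)
    exact ⟨fun h ↦ by simpa using sub_mem h this, fun h ↦ by simpa using add_mem this h⟩
  have hP : (σ • 𝔓).under A = 𝔓.under A := by
    ext x
    change (x : 𝓞 QBar) ∈ σ • 𝔓 ↔ (x : 𝓞 QBar) ∈ 𝔓
    rw [Ideal.mem_pointwise_smul_iff_inv_smul_mem, hA']
  -- `σ • 𝔓` and `𝔓` lie over the same prime of the `H`-invariants, so `H` carries one to the other.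
  obtain ⟨τ, hτ⟩ := Algebra.IsInvariant.exists_smul_of_under_eq_of_profinite (G := H) _ _ hP
  have hτ' : ((τ : GQ) * σ) • 𝔓 = 𝔓 := by
    rw [mul_smul]
    exact hτ.symm
  set g : GQ := (τ : GQ) * σ with hg
  -- `g` now stabilises `𝔓` and acts trivially on `A` modulo `𝔓`. The automorphism it induces on the
  -- quotient is also induced by some `γ` in `H`, and `γ⁻¹ * g` lies in the inertia group.
  let f : (𝓞 QBar ⧸ 𝔓) ≃+* (𝓞 QBar ⧸ 𝔓) :=
    Ideal.quotientEquiv 𝔓 𝔓 (MulSemiringAction.toRingEquiv GQ (𝓞 QBar) g) hτ'.symm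
  let f' : (𝓞 QBar ⧸ 𝔓) ≃ₐ[A ⧸ 𝔓.under A] (𝓞 QBar ⧸ 𝔓) :=
    AlgEquiv.ofRingEquiv (f := f) (by
      intro x
      obtain ⟨x, rfl⟩ := Ideal.Quotient.mk_surjective x
      exact Ideal.Quotient.eq.mpr (h g x (hA x)))
  obtain ⟨γ, hγ⟩ := Ideal.Quotient.stabilizerHom_surjective_of_profinite (G := H)
    (𝔓.under A) 𝔓 f'
  have hγ' (x : 𝓞 QBar) : (γ : H) • x - g • x ∈ 𝔓 :=
    Ideal.Quotient.eq.mp (DFunLike.congr_fun hγ (Ideal.Quotient.mk 𝔓 x))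
  refine ⟨((γ : H) : GQ)⁻¹ * τ, mul_mem (inv_mem (γ : H).2) τ.2, fun x ↦ ?_⟩
  have h1 : ((γ : H) : GQ) • 𝔓 = 𝔓 := γ.2
  change (((γ : H) : GQ)⁻¹ * τ * σ) • x - x ∈ 𝔓
  rw [mul_assoc, mul_smul, ← hg, ← Ideal.smul_mem_pointwise_smul_iff (a := ((γ : H) : GQ)), h1,
    smul_sub, smul_inv_smul, ← neg_mem_iff, neg_sub]
  exact hγ' x

theorem exists_intCast_eq_of_isIntegral {E : Type*} [Field E] [CharZero E] {r : ℚ}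
    (h : IsIntegral ℤ (r : E)) : ∃ n : ℤ, (n : ℚ) = r := by
  have h' : IsIntegral ℤ (algebraMap ℚ E r) := by simpa using h
  rw [isIntegral_algebraMap_iff (algebraMap ℚ E).injective] at h'
  exact IsIntegrallyClosed.isIntegral_iff.mp h'

theorem exists_liesAbove {ℓ : ℕ} (hℓ : ℓ.Prime) : ∃ 𝔓 : Ideal (𝓞 QBar), LiesAbove 𝔓 ℓ := by
  have h : Ideal.span {(ℓ : 𝓞 QBar)} ≠ ⊤ := by
    rw [Ne, Ideal.span_singleton_eq_top]
    intro hu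
    obtain ⟨u, hu⟩ := hu.exists_right_inv
    have hu' : (ℓ : QBar) * u = 1 := by exact_mod_cast congrArg (fun y : 𝓞 QBar ↦ (y : QBar)) hu
    have hint : IsIntegral ℤ (((ℓ : ℚ)⁻¹ : ℚ) : QBar) := by
      have : (((ℓ : ℚ)⁻¹ : ℚ) : QBar) = u := by
        push_cast
        exact (eq_inv_of_mul_eq_one_right hu').symm
      rw [this]
      exact NumberField.RingOfIntegers.isIntegral_coe u
    obtain ⟨n, hn⟩ := exists_intCast_eq_of_isIntegral hint
    have hn' : (ℓ : ℤ) * n = 1 := by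
      have : (ℓ : ℚ) ≠ 0 := by exact_mod_cast hℓ.ne_zero
      have : (ℓ : ℚ) * n = 1 := by rw [hn]; field_simp
      exact_mod_cast this
    exact hℓ.one_lt.ne' (by simpa using Int.eq_one_or_neg_one_of_mul_eq_one hn')
  obtain ⟨M, hM, hle⟩ := Ideal.exists_le_maximal _ h
  exact ⟨M, hM.isPrime, hle (Ideal.mem_span_singleton_self _)⟩

theorem LiesAbove.intCast_mem_iff {ℓ : ℕ} (hℓ : ℓ.Prime) {𝔓 : Ideal (𝓞 QBar)}
    (h : LiesAbove 𝔓 ℓ) (n : ℤ) : (n : 𝓞 QBar) ∈ 𝔓 ↔ (ℓ : ℤ) ∣ n := by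
  have := h.1
  constructor
  · intro hn
    by_contra hd
    obtain ⟨a, b, hab⟩ := (Int.prime_iff_natAbs_prime.mpr (by simpa using hℓ)).coprime_iff_not_dvd.mpr hd
    refine (Ideal.ne_top_iff_one 𝔓).mp this.ne_top ?_
    have h1 : ((a * ℓ + b * n : ℤ) : 𝓞 QBar) = 1 := by rw [hab]; simp
    rw [← h1]
    push_cast
    exact add_mem (Ideal.mul_mem_left _ _ h.2) (Ideal.mul_mem_left _ _ hn)
  · rintro ⟨c, rfl⟩
    push_cast
    exact Ideal.mul_mem_right _ _ h.2

end Inertia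

/-! ### Discriminant and splitting of primes in quadratic fields -/

section Quadratic

open Polynomial IntermediateField Matrix

/-- The form `X² - X + c`, of discriminant `1 - 4c`, treats the prime `2` on the same footing as the
odd primes. -/
theorem irreducible_quadratic {c : ℤ} (hc : ¬ IsSquare (1 - 4 * c)) :
    Irreducible (X ^ 2 - X + C (c : ℚ) : ℚ[X]) := by
  have hd : (X ^ 2 - X + C (c : ℚ) : ℚ[X]).natDegree = 2 := by compute_degree!
  refine Polynomial.irreducible_of_degree_le_three_of_not_isRoot (by rw [hd]; decide) fun x hx ↦ hc ?_
  have : IsSquare ((1 - 4 * c : ℤ) : ℚ) := by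
    refine ⟨2 * x - 1, ?_⟩
    simp only [IsRoot.def, eval_add, eval_sub, eval_pow, eval_X, eval_C] at hx
    push_cast
    linear_combination -4 * hx
  exact Rat.isSquare_intCast_iff.mp this

theorem minpoly_quadratic {E : Type*} [Field E] [Algebra ℚ E] {c : ℤ} (hc : ¬ IsSquare (1 - 4 * c))
    {a : E} (ha : a ^ 2 - a + c = 0) : minpoly ℚ a = X ^ 2 - X + C (c : ℚ) :=
  (minpoly.eq_of_irreducible_of_monic (irreducible_quadratic hc) (by simpa using ha)
    (by monicity!)).symm

variable {K : Type*} [Field K] [NumberField K] (hK : Module.finrank ℚ K = 2) {c : ℤ}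
  (hc : ¬ IsSquare (1 - 4 * c)) {a : 𝓞 K} (ha : a ^ 2 - a + c = 0)

include hK hc ha

omit hc ha in
theorem trace_one_quadratic : Algebra.trace ℤ (𝓞 K) 1 = 2 := by
  have hfr : Module.finrank ℤ (𝓞 K) = 2 := by rw [NumberField.RingOfIntegers.rank, hK]
  have := Algebra.trace_algebraMap (R := ℤ) (S := 𝓞 K) 1
  rw [hfr] at this
  simpa using this

theorem trace_quadratic : Algebra.trace ℤ (𝓞 K) a = 1 := by
  have ha' : (a : K) ^ 2 - a + c = 0 := by simpa using congrArg (algebraMap (𝓞 K) K) ha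
  have hm := minpoly_quadratic hc ha'
  have hd : (X ^ 2 - X + C (c : ℚ) : ℚ[X]).natDegree = 2 := by compute_degree!
  have hf : Module.finrank ℚ ℚ⟮(a : K)⟯ = 2 := by
    rw [IntermediateField.adjoin.finrank (Algebra.IsIntegral.isIntegral _), hm, hd]
  have hf' : Module.finrank ℚ⟮(a : K)⟯ K = 1 := by
    have := Module.finrank_mul_finrank ℚ ℚ⟮(a : K)⟯ K
    rw [hf, hK] at this
    omega
  have := trace_eq_finrank_mul_minpoly_nextCoeff ℚ (a : K)
  rw [hf', hm, nextCoeff_of_natDegree_pos (by omega), hd] at this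
  have h1 : Algebra.trace ℚ K a = 1 := by
    rw [this, coeff_add, coeff_C]
    simp [coeff_X]
  rw [← Algebra.coe_trace_int] at h1
  exact_mod_cast h1

/-- The order `ℤ[a]` has discriminant `1 - 4c`, which is the field discriminant times the square of
a base change determinant. -/
theorem discr_dvd_of_quadratic : NumberField.discr K ∣ 1 - 4 * c := by
  have hfr : Module.finrank ℤ (𝓞 K) = 2 := by rw [NumberField.RingOfIntegers.rank, hK]
  let b : Module.Basis (Fin 2) ℤ (𝓞 K) := Module.finBasisOfFinrankEq ℤ (𝓞 K) hfr
  have hb := NumberField.discr_eq_discr K b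
  have ht := trace_quadratic hK hc ha
  have ht1 := trace_one_quadratic hK
  have ht2 : Algebra.trace ℤ (𝓞 K) (a * a) = 1 - 2 * c := by
    have : a * a = a - c • (1 : 𝓞 K) := by
      rw [zsmul_one]; linear_combination ha
    rw [this, map_sub, map_zsmul, ht, ht1]
    simp [mul_comm]
  have hD : Algebra.discr ℤ ![1, a] = 1 - 4 * c := by
    rw [Algebra.discr_def, Matrix.det_fin_two]
    simp [Algebra.traceMatrix, Algebra.traceForm_apply, ht, ht1, ht2]
    ring
  rw [← hD, ← hb]
  have hP : ![1, a] = (b : Fin 2 → 𝓞 K) ᵥ* (b.toMatrix ![1, a]).map (algebraMap ℤ (𝓞 K)) := by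
    ext i : 1
    rw [← b.sum_toMatrix_smul_self ![1, a] i]
    simp [Matrix.vecMul, dotProduct, mul_comm]
  rw [hP, Algebra.discr_of_matrix_vecMul]
  exact Dvd.intro_left _ rfl

omit hc ha in
theorem absNorm_span_natCast_quadratic (ℓ : ℕ) :
    Ideal.absNorm (Ideal.span {(ℓ : 𝓞 K)}) = ℓ ^ 2 := by
  have hfr : Module.finrank ℤ (𝓞 K) = 2 := by rw [NumberField.RingOfIntegers.rank, hK]
  rw [Ideal.absNorm_span_natCast, hfr]

/-- The factors are `(ℓ, a - s)` and `(ℓ, a - (1 - s))`, one for each root modulo `ℓ`; they are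
coprime because the roots differ by `2s - 1`, a unit modulo `ℓ`. -/
theorem splitsIn_of_root {ℓ : ℕ} (hℓ : ℓ.Prime) (s : ℤ) (hs : (ℓ : ℤ) ∣ s ^ 2 - s + c)
    (hs' : ¬ (ℓ : ℤ) ∣ 2 * s - 1) : SplitsIn ℓ K := by
  -- If `ℓ` divided `a - t`, it would divide the trace `1 - 2t`.
  have key : ∀ t : ℤ, ¬ (ℓ : ℤ) ∣ 2 * t - 1 → Ideal.span {(ℓ : 𝓞 K)} ≠ Ideal.span {(ℓ : 𝓞 K), a - t} := by
    intro t ht heq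
    have : a - t ∈ Ideal.span {(ℓ : 𝓞 K)} := heq ▸ Ideal.subset_span (by simp)
    obtain ⟨y, hy⟩ := Ideal.mem_span_singleton'.mp this
    have h1 := trace_quadratic hK hc ha
    have h2 := trace_one_quadratic hK
    have h3 : Algebra.trace ℤ (𝓞 K) ((ℓ : ℤ) • y) = Algebra.trace ℤ (𝓞 K) (a - t • (1 : 𝓞 K)) := by
      congr 1
      rw [zsmul_one, ← hy]; simp [mul_comm]
    rw [map_zsmul, map_sub, map_zsmul, h1, h2] at h3
    apply ht
    refine ⟨-Algebra.trace ℤ (𝓞 K) y, ?_⟩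
    simp only [smul_eq_mul] at h3
    linear_combination h3
  set v : Ideal (𝓞 K) := Ideal.span {(ℓ : 𝓞 K), a - s} with hv
  set w : Ideal (𝓞 K) := Ideal.span {(ℓ : 𝓞 K), a - (1 - s : ℤ)} with hw
  have hvw : v ⊔ w = ⊤ := by
    rw [Ideal.eq_top_iff_one]
    obtain ⟨x, y, hxy⟩ := (Nat.prime_iff_prime_int.mp hℓ).coprime_iff_not_dvd.mpr hs'
    have h1 : ((x * ℓ + y * (2 * s - 1) : ℤ) : 𝓞 K) = 1 := by rw [hxy]; simp
    have h2 : (1 : 𝓞 K) = (x * ℓ - y * (a - s)) + y * (a - (1 - s : ℤ)) := by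
      rw [← h1]; push_cast; ring
    rw [h2]
    refine Submodule.add_mem_sup (sub_mem ?_ ?_) ?_ <;>
      exact Ideal.mul_mem_left _ _ (Ideal.subset_span (by simp))
  have hmul : Ideal.span {(ℓ : 𝓞 K)} = v * w := by
    apply le_antisymm
    · rw [Ideal.mul_eq_inf_of_coprime hvw, Ideal.span_singleton_le_iff_mem]
      exact ⟨Ideal.subset_span (by simp), Ideal.subset_span (by simp)⟩
    · rw [hv, hw, Ideal.span_pair_mul_span_pair, Ideal.span_le]
      have h1 : (a - s) * (a - (1 - s : ℤ)) ∈ Ideal.span {(ℓ : 𝓞 K)} := by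
        obtain ⟨m, hm⟩ := hs
        have hm' : (s : 𝓞 K) ^ 2 - s + c = ℓ * m := by exact_mod_cast congrArg (Int.cast : ℤ → 𝓞 K) hm
        rw [Ideal.mem_span_singleton']
        refine ⟨-m, ?_⟩
        push_cast
        linear_combination hm' - ha
      have h0 : (ℓ : 𝓞 K) ∈ Ideal.span {(ℓ : 𝓞 K)} := Ideal.mem_span_singleton_self _
      rintro x hx
      simp only [Set.mem_insert_iff, Set.mem_singleton_iff] at hx
      rcases hx with rfl | rfl | rfl | rfl
      · exact Ideal.mul_mem_left _ _ h0
      · exact Ideal.mul_mem_right _ _ h0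
      · exact Ideal.mul_mem_left _ _ h0
      · exact h1
  have hN : Ideal.absNorm v * Ideal.absNorm w = ℓ ^ 2 := by
    rw [← map_mul, ← hmul, absNorm_span_natCast_quadratic hK]
  have hv1 : Ideal.absNorm v ≠ 1 := by
    rw [Ne, Ideal.absNorm_eq_one_iff]
    intro h
    rw [h, Ideal.top_mul] at hmul
    refine key (1 - s) (fun h ↦ hs' ?_) hmul
    rw [← dvd_neg, show -(2 * s - 1) = 2 * (1 - s) - 1 by ring]
    exact h
  have hw1 : Ideal.absNorm w ≠ 1 := by
    rw [Ne, Ideal.absNorm_eq_one_iff]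
    intro h
    rw [h, Ideal.mul_top] at hmul
    exact key s hs' hmul
  have hN' := (Nat.Prime.mul_eq_prime_sq_iff hℓ hv1 hw1).mp hN
  refine ⟨v, w, Ideal.isPrime_of_irreducible_absNorm (hN'.1 ▸ hℓ),
    Ideal.isPrime_of_irreducible_absNorm (hN'.2 ▸ hℓ), ?_, hmul⟩
  intro h
  rw [h, sup_idem] at hvw
  exact hw1 (Ideal.absNorm_eq_one_iff.mpr hvw)

omit hc in
-- A prime of norm `ℓ` has residue ring generated additively by `1`, so `a` would reduce to an
-- integer root. Hence a prime above `ℓ` has norm `ℓ²`, the norm of `(ℓ)`.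
theorem inertIn_of_no_root {ℓ : ℕ} (hℓ : ℓ.Prime) (h : ∀ s : ℤ, ¬ (ℓ : ℤ) ∣ s ^ 2 - s + c) :
    InertIn ℓ K := by
  have hN := absNorm_span_natCast_quadratic hK ℓ
  have htop : Ideal.span {(ℓ : 𝓞 K)} ≠ ⊤ := by
    intro h
    rw [h, Ideal.absNorm_top] at hN
    have := hℓ.one_lt
    nlinarith
  obtain ⟨P, hP, hle⟩ := Ideal.exists_le_maximal _ htop
  have hdvd : Ideal.absNorm P ∣ ℓ ^ 2 := hN ▸ Ideal.absNorm_dvd_absNorm_of_le hle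
  obtain ⟨i, hi, hPi⟩ := (Nat.dvd_prime_pow hℓ).mp hdvd
  interval_cases i
  · exact absurd (Ideal.absNorm_eq_one_iff.mp hPi) hP.ne_top
  · exfalso
    rw [pow_one] at hPi
    have hcard : Nat.card (𝓞 K ⧸ P) = ℓ := hPi
    have := Fact.mk hℓ
    have h10 : (1 : 𝓞 K ⧸ P) ≠ 0 := by
      have := Ideal.Quotient.nontrivial_iff.mpr hP.ne_top
      exact one_ne_zero
    obtain ⟨s, hs⟩ := AddSubgroup.mem_zmultiples_iff.mp
      (mem_zmultiples_of_prime_card hcard h10 (g' := Ideal.Quotient.mk P a))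
    have hs' : Ideal.Quotient.mk P a = (s : ℤ) := by rw [← hs, zsmul_one]
    have hroot : ((s ^ 2 - s + c : ℤ) : 𝓞 K ⧸ P) = 0 := by
      push_cast
      rw [← hs']
      simpa using congrArg (Ideal.Quotient.mk P) ha
    obtain ⟨x, y, hxy⟩ := (Nat.prime_iff_prime_int.mp hℓ).coprime_iff_not_dvd.mpr (h s)
    have hℓ0 : (ℓ : 𝓞 K ⧸ P) = 0 := by
      simpa using Ideal.Quotient.eq_zero_iff_mem.mpr (hle (Ideal.mem_span_singleton_self _))
    apply h10
    have h1 : ((x * ℓ + y * (s ^ 2 - s + c) : ℤ) : 𝓞 K ⧸ P) = 1 := by rw [hxy]; simp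
    rw [← h1, Int.cast_add, Int.cast_mul, Int.cast_mul, hroot, Int.cast_natCast, hℓ0]
    simp
  · have : Ideal.span {(ℓ : 𝓞 K)} = P := by
      obtain ⟨J, hJ⟩ := Ideal.dvd_iff_le.mpr hle
      rw [hJ, map_mul, hPi] at hN
      have : Ideal.absNorm J = 1 :=
        Nat.eq_of_mul_eq_mul_left (pow_pos hℓ.pos 2) (by rw [hN, mul_one])
      rw [hJ, Ideal.absNorm_eq_one_iff.mp this, Ideal.mul_top]
    rw [InertIn, this]
    exact hP.isPrime

end Quadratic

/-! ### Quadratic subfields of `QBar` and their ramification -/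

section QuadraticSubfield

open Polynomial IntermediateField

theorem exists_quadratic_root (c : ℤ) : ∃ α : QBar, α ^ 2 - α + c = 0 := by
  have hd : (X ^ 2 - X + C (c : QBar) : QBar[X]).natDegree = 2 := by compute_degree!
  obtain ⟨α, hα⟩ := IsAlgClosed.exists_root (X ^ 2 - X + C (c : QBar)) (by
    intro h
    rw [natDegree_eq_of_degree_eq_some h] at hd
    exact two_ne_zero hd.symm)
  exact ⟨α, by simpa using hα⟩

theorem not_isSquare_of_natAbs_prime {d : ℤ} (h : d.natAbs.Prime) : ¬ IsSquare d := by
  rintro ⟨x, rfl⟩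
  rw [Int.natAbs_mul] at h
  rcases Nat.prime_mul_iff.mp h with ⟨h, h'⟩ | ⟨h, h'⟩ <;> exact h.ne_one h'

variable {c : ℤ} (hc : ¬ IsSquare (1 - 4 * c)) {α : QBar} (hα : α ^ 2 - α + c = 0)

section
include hα

omit hc in
theorem apply_root_eq_or (σ : GQ) : σ α = α ∨ σ α = 1 - α := by
  have h : (σ α) ^ 2 - σ α + c = 0 := by simpa using congrArg σ hα
  have : (σ α - α) * (σ α - (1 - α)) = 0 := by linear_combination h - hα
  rcases mul_eq_zero.mp this with h | h
  · exact .inl (sub_eq_zero.mp h)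
  · exact .inr (sub_eq_zero.mp h)

omit hα in
theorem mem_fixingSubgroup_adjoin_iff (σ : GQ) : σ ∈ ℚ⟮α⟯.fixingSubgroup ↔ σ α = α := by
  constructor
  · intro h
    exact h ⟨α, mem_adjoin_simple_self ℚ α⟩
  · intro h
    rw [← Subgroup.zpowers_le, ← le_iff_le, adjoin_simple_le_iff]
    rintro ⟨τ, hτ⟩
    obtain ⟨n, rfl⟩ := Subgroup.mem_zpowers_iff.mp hτ
    exact zpow_mem (K := MulAction.stabilizer GQ α) h n

theorem mem_fixingSubgroup_or_mul {σ τ : GQ} (hτ : τ ∉ ℚ⟮α⟯.fixingSubgroup) :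
    σ ∈ ℚ⟮α⟯.fixingSubgroup ∨ τ * σ ∈ ℚ⟮α⟯.fixingSubgroup := by
  rw [mem_fixingSubgroup_adjoin_iff] at hτ
  rw [mem_fixingSubgroup_adjoin_iff, mem_fixingSubgroup_adjoin_iff]
  refine (apply_root_eq_or hα σ).imp_right fun h ↦ ?_
  rw [AlgEquiv.mul_apply, h, map_sub, map_one, (apply_root_eq_or hα τ).resolve_left hτ]
  ring

theorem exists_eq_add_mul_of_mem_adjoin {x : QBar} (hx : x ∈ ℚ⟮α⟯) :
    ∃ u v : ℚ, x = u + v * α := by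
  have hint : IsIntegral ℚ α := Algebra.IsIntegral.isIntegral _
  have hx' : x ∈ Algebra.adjoin ℚ {α} := by
    rwa [← IntermediateField.mem_toSubalgebra,
      adjoin_simple_toSubalgebra_of_isAlgebraic hint.isAlgebraic] at hx
  clear hx
  induction hx' using Algebra.adjoin_induction with
  | mem x hx =>
    rw [Set.mem_singleton_iff] at hx
    exact ⟨0, 1, by simp [hx]⟩
  | algebraMap r => exact ⟨r, 0, by simp⟩
  | add x y hx hy ihx ihy =>
    obtain ⟨u, v, rfl⟩ := ihx
    obtain ⟨u', v', rfl⟩ := ihy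
    exact ⟨u + u', v + v', by push_cast; ring⟩
  | mul x y hx hy ihx ihy =>
    obtain ⟨u, v, rfl⟩ := ihx
    obtain ⟨u', v', rfl⟩ := ihy
    refine ⟨u * u' - v * v' * c, u * v' + v * u' + v * v', ?_⟩
    push_cast
    linear_combination (v * v' : QBar) * hα

omit hα in
theorem isIntegral_root {E : Type*} [Field E] {a : E} (ha : a ^ 2 - a + c = 0) : IsIntegral ℤ a :=
  ⟨X ^ 2 - X + C c, by monicity!, by
    simp only [eval₂_add, eval₂_sub, eval₂_pow, eval₂_X, eval₂_C]
    simpa using ha⟩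

theorem exists_integer_root : ∃ a : 𝓞 ℚ⟮α⟯, a ^ 2 - a + c = 0 := by
  have h : (AdjoinSimple.gen ℚ α) ^ 2 - AdjoinSimple.gen ℚ α + c = 0 := by
    apply Subtype.ext
    simpa using hα
  have hint : IsIntegral ℤ (AdjoinSimple.gen ℚ α) := isIntegral_root h
  obtain ⟨a, ha⟩ : ∃ a : 𝓞 ℚ⟮α⟯, (a : ℚ⟮α⟯) = AdjoinSimple.gen ℚ α := ⟨⟨_, hint⟩, rfl⟩
  exact ⟨a, NumberField.RingOfIntegers.ext (by simpa [ha] using h)⟩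

include hc

theorem finrank_adjoin_quadratic_root : Module.finrank ℚ ℚ⟮α⟯ = 2 := by
  have hd : (X ^ 2 - X + C (c : ℚ) : ℚ[X]).natDegree = 2 := by compute_degree!
  have := adjoin.finrank (K := ℚ) (x := α) (Algebra.IsIntegral.isIntegral _)
  rw [minpoly_quadratic hc hα, hd] at this
  convert this

theorem numberField_adjoin_quadratic_root : NumberField ℚ⟮α⟯ where
  to_finiteDimensional := Module.finite_of_finrank_pos
    (by rw [finrank_adjoin_quadratic_root hc hα]; norm_num)

theorem exists_notMem_fixingSubgroup : ∃ σ : GQ, σ ∉ ℚ⟮α⟯.fixingSubgroup := by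
  by_contra! h
  have : ℚ⟮α⟯ ≤ ⊥ := by
    rw [adjoin_simple_le_iff, InfiniteGalois.mem_bot_iff_fixed]
    exact fun σ ↦ (mem_fixingSubgroup_adjoin_iff σ).mp (h σ)
  have h2 := finrank_adjoin_quadratic_root hc hα
  have h1 : Module.finrank ℚ (⊥ : IntermediateField ℚ QBar) = 1 := IntermediateField.finrank_bot
  rw [le_bot_iff.mp this] at h2
  rw [h1] at h2
  omega

theorem isRealQuadratic_adjoin_quadratic_root (hpos : 0 < 1 - 4 * c) [NumberField ℚ⟮α⟯] :
    IsRealQuadratic ℚ⟮α⟯ := by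
  refine ⟨finrank_adjoin_quadratic_root hc hα, ⟨fun w ↦ ?_⟩⟩
  rw [NumberField.InfinitePlace.isReal_iff, NumberField.ComplexEmbedding.isReal_iff]
  set φ := w.embedding
  set z := φ (AdjoinSimple.gen ℚ α) with hz
  have h : (AdjoinSimple.gen ℚ α) ^ 2 - AdjoinSimple.gen ℚ α + c = 0 := by
    apply Subtype.ext
    simpa using hα
  have hz2 : (2 * z - 1) ^ 2 = ((1 - 4 * c : ℝ) : ℂ) := by
    have := congrArg φ h
    simp only [map_add, map_sub, map_pow, map_intCast, map_zero, ← hz] at this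
    push_cast
    linear_combination 4 * this
  have hre := congrArg Complex.re hz2
  have him := congrArg Complex.im hz2
  rw [Complex.ofReal_re] at hre
  rw [Complex.ofReal_im] at him
  simp only [pow_two, Complex.mul_re, Complex.mul_im, Complex.sub_re, Complex.sub_im,
    Complex.re_ofNat, Complex.im_ofNat, Complex.one_re, Complex.one_im] at hre him
  have hpos' : (0 : ℝ) < 1 - 4 * c := by exact_mod_cast hpos
  have hzim : z.im = 0 := by
    by_contra hne
    have : 2 * z.re - 1 = 0 := by
      have : z.im * (2 * z.re - 1) = 0 := by linarith
      exact (mul_eq_zero.mp this).resolve_left hne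
    nlinarith [sq_nonneg z.im]
  ext x
  obtain ⟨u, v, hx⟩ := exists_eq_add_mul_of_mem_adjoin hα x.2
  have hx' : x = u + v * AdjoinSimple.gen ℚ α := Subtype.ext (by simpa using hx)
  rw [NumberField.ComplexEmbedding.conjugate_coe_eq, hx']
  simp only [map_add, map_mul, map_ratCast, ← hz, Complex.conj_eq_iff_im.mpr hzim]

theorem isImaginaryQuadratic_adjoin_quadratic_root (hneg : 1 - 4 * c < 0) [NumberField ℚ⟮α⟯] :
    IsImaginaryQuadratic ℚ⟮α⟯ := by
  refine ⟨finrank_adjoin_quadratic_root hc hα, ⟨fun w ↦ ?_⟩⟩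
  rw [← NumberField.InfinitePlace.not_isReal_iff_isComplex]
  intro hw
  let f : ℚ⟮α⟯ →+* ℝ := NumberField.InfinitePlace.embedding_of_isReal hw
  obtain ⟨a, ha⟩ := exists_integer_root hα
  have h : (f a) ^ 2 - f a + c = 0 := by simpa using congrArg (fun x : 𝓞 ℚ⟮α⟯ ↦ f x) ha
  have : (1 - 4 * c : ℝ) < 0 := by exact_mod_cast hneg
  nlinarith [sq_nonneg (2 * f a - 1)]

end

/-- If nonzero, `v² d` has odd valuation at `q`, so as an integer it is divisible by `q`. -/
theorem prime_dvd_of_rat_sq_mul {q : ℕ} (hq : q.Prime) {d m : ℤ} (hd : d.natAbs = q) {v : ℚ}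
    (h : (m : ℚ) = v ^ 2 * d) : (q : ℤ) ∣ m := by
  by_contra hm
  have hq' := Nat.prime_iff_prime_int.mp hq
  have hqd : (q : ℤ) ∣ d := by rw [← hd, Int.natAbs_dvd]
  have h1 : m * v.den ^ 2 = v.num ^ 2 * d := by
    have : (v.den : ℚ) ≠ 0 := by exact_mod_cast v.den_ne_zero
    have hv : v * v.den = v.num := Rat.mul_den_eq_num v
    have : (m : ℚ) * v.den ^ 2 = v.num ^ 2 * d := by
      rw [h, ← hv]; ring
    exact_mod_cast this
  have h2 : (q : ℤ) ∣ v.den := by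
    refine hq'.dvd_of_dvd_pow (n := 2) ((hq'.dvd_or_dvd ?_).resolve_left hm)
    rw [h1]
    exact Dvd.dvd.mul_left hqd _
  obtain ⟨e, he⟩ := h2
  have h3 : (q : ℤ) ∣ v.num := by
    refine hq'.dvd_of_dvd_pow (n := 2) ?_
    have : (q : ℤ) * q ∣ v.num ^ 2 * q := by
      have : v.num ^ 2 * d = q * q * (m * e ^ 2) := by rw [← h1, he]; ring
      rcases Int.natAbs_eq d with h | h <;> rw [h, hd] at this
      · exact ⟨_, this⟩
      · exact ⟨-(m * e ^ 2), by linear_combination -this⟩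
    exact Int.dvd_of_mul_dvd_mul_right hq'.ne_zero this
  have h4 : (q : ℤ) ∣ (1 : ℤ) := by
    have := Int.dvd_coe_gcd h3 ⟨e, he⟩
    rwa [show Int.gcd v.num v.den = 1 from v.reduced] at this
  exact hq'.not_isUnit (isUnit_of_dvd_one h4)

include hα

/-- This is total ramification at `q`. If `x = u + vα` and `σ` moves `α`, then `(σx - x)² = v²(1 -
4c)` is a rational integer divisible by `q`. -/
theorem smul_sub_mem_of_ramified {q : ℕ} (hq : q.Prime) (hd : (1 - 4 * c).natAbs = q)
    {𝔓 : Ideal (𝓞 QBar)} (h𝔓 : LiesAbove 𝔓 q) (σ : GQ) (x : 𝓞 QBar) (hx : (x : QBar) ∈ ℚ⟮α⟯) :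
    σ • x - x ∈ 𝔓 := by
  obtain ⟨u, v, hx⟩ := exists_eq_add_mul_of_mem_adjoin hα hx
  rcases apply_root_eq_or hα σ with h | h
  · have : σ • x - x = 0 := by
      apply NumberField.RingOfIntegers.ext
      simp [hx, h]
    rw [this]
    exact zero_mem _
  · set y := σ • x - x with hy
    have hy2 : ((y ^ 2 : 𝓞 QBar) : QBar) = ((v ^ 2 * (1 - 4 * c : ℤ) : ℚ) : QBar) := by
      simp [hy, hx, h]
      linear_combination (4 * (v : QBar) ^ 2) * hα
    obtain ⟨m, hm⟩ := exists_intCast_eq_of_isIntegral (E := QBar) (r := v ^ 2 * (1 - 4 * c : ℤ))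
      (by rw [← hy2]; exact (y ^ 2).isIntegral_coe)
    have hy3 : y ^ 2 = (m : 𝓞 QBar) := by
      apply NumberField.RingOfIntegers.ext
      rw [hy2, ← hm]
      simp
    refine h𝔓.1.mem_of_pow_mem 2 ?_
    rw [hy3, h𝔓.intCast_mem_iff hq]
    exact prime_dvd_of_rat_sq_mul hq hd hm

/-- If `σ` moves `α`, then `σα - α = 1 - 2α` lies in `𝔓`, and so does its square `1 - 4c`. -/
theorem mem_fixingSubgroup_of_unramified {ℓ : ℕ} (hℓ : ℓ.Prime) (hd : ¬ (ℓ : ℤ) ∣ 1 - 4 * c)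
    {𝔓 : Ideal (𝓞 QBar)} (h𝔓 : LiesAbove 𝔓 ℓ) {σ : GQ} (hσ : σ ∈ 𝔓.inertia GQ) :
    σ ∈ ℚ⟮α⟯.fixingSubgroup := by
  rw [mem_fixingSubgroup_adjoin_iff]
  by_contra h
  obtain ⟨a, ha⟩ : ∃ a : 𝓞 QBar, (a : QBar) = α := ⟨⟨α, isIntegral_root hα⟩, rfl⟩
  apply hd
  rw [← h𝔓.intCast_mem_iff hℓ]
  convert Ideal.pow_mem_of_mem 𝔓 (hσ a) 2 (by norm_num) using 1
  apply NumberField.RingOfIntegers.ext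
  refine (map_intCast (algebraMap (𝓞 QBar) QBar) _).trans ?_
  simp [ha, (apply_root_eq_or hα σ).resolve_left h]
  linear_combination -4 * hα

/-- Adjoining a quadratic field of prime discriminant `± q` preserves irreducibility if `q` is
unramified in everything else. -/
theorem IrreducibleOver.sup_quadratic {k : Type*} [Field k] {r : GQ →* GL (Fin 2) k}
    {L : IntermediateField ℚ QBar} (h : IrreducibleOver r L)
    {q : ℕ} (hq : q.Prime) (hd : (1 - 4 * c).natAbs = q)
    (hr : ∀ 𝔓 : Ideal (𝓞 QBar), LiesAbove 𝔓 q → ∀ σ ∈ 𝔓.inertia GQ,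
      r σ = 1 ∧ σ ∈ L.fixingSubgroup) :
    IrreducibleOver r (ℚ⟮α⟯ ⊔ L) := by
  obtain ⟨𝔓, h𝔓⟩ := exists_liesAbove hq
  have := h𝔓.1
  obtain ⟨σ, hσ⟩ := exists_notMem_fixingSubgroup
    (not_isSquare_of_natAbs_prime (hd ▸ hq)) hα
  -- Total ramification moves `σ` into inertia without changing its action on `α`.
  obtain ⟨γ, hγ, hτ⟩ := exists_mul_mem_inertia 𝔓 ℚ⟮α⟯ (smul_sub_mem_of_ramified hα hq hd h𝔓) σ
  have hτ' : γ * σ ∉ ℚ⟮α⟯.fixingSubgroup := fun h ↦ hσ ((Subgroup.mul_mem_cancel_left _ hγ).mp h)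
  refine h.of_index_two r (hr 𝔓 h𝔓 _ hτ).1 fun g hg ↦ ?_
  rw [fixingSubgroup_sup, Subgroup.mem_inf, Subgroup.mem_inf]
  exact (mem_fixingSubgroup_or_mul hα hτ').imp (⟨·, hg⟩)
    (⟨·, mul_mem (hr 𝔓 h𝔓 _ hτ).2 hg⟩)

end QuadraticSubfield

/-! ### Ramification in `ℚ(ζ_p)` and the cyclotomic character -/

section Cyclotomic

open IntermediateField

theorem map_eval₂_intCastRingHom {R S : Type*} [CommRing R] [CommRing S] (f : R →+* S)
    (P : Polynomial ℤ) (x : R) :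
    f (P.eval₂ (Int.castRingHom R) x) = P.eval₂ (Int.castRingHom S) (f x) := by
  rw [Polynomial.hom_eval₂, RingHom.eq_intCast' (f.comp (Int.castRingHom R))]

theorem exists_eval₂_eq_of_isIntegral {E : Type*} [Field E] [CharZero E] {p : ℕ} [Fact p.Prime]
    [IsCyclotomicExtension {p} ℚ E] {ζ : E} (hζ : IsPrimitiveRoot ζ p) {x : E}
    (hx : IsIntegral ℤ x) : ∃ P : Polynomial ℤ, P.eval₂ (Int.castRingHom E) ζ = x := by
  have := IsCyclotomicExtension.Rat.isIntegralClosure_adjoin_singleton_of_prime hζ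
  obtain ⟨⟨y, hy⟩, rfl⟩ := (IsIntegralClosure.isIntegral_iff
    (A := Algebra.adjoin ℤ ({ζ} : Set E))).mp hx
  rw [Algebra.adjoin_singleton_eq_range_aeval] at hy
  exact hy

variable {p : ℕ} [hp : Fact p.Prime] {ζ : QBar} (hζ : IsPrimitiveRoot ζ p)
include hζ

theorem cyclotomicSubfield_eq_adjoin : cyclotomicSubfield p = ℚ⟮ζ⟯ := by
  apply le_antisymm
  · rw [cyclotomicSubfield, adjoin_le_iff]
    intro ξ hξ
    obtain ⟨i, -, rfl⟩ := hζ.eq_pow_of_pow_eq_one hξ.pow_eq_one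
    exact pow_mem (mem_adjoin_simple_self ℚ ζ) i
  · exact adjoin.mono _ _ _ (Set.singleton_subset_iff.mpr hζ)

/-- This is total ramification at `p`. Modulo `𝔓` one has `X ^ p - 1 = (X - 1) ^ p`, so every `p`-th
root of unity reduces to `1`, and the integers of `ℚ(ζ_p)` are integral polynomials in `ζ`. -/
theorem apply_primitiveRoot_sub_mem {𝔓 : Ideal (𝓞 QBar)} (h𝔓 : LiesAbove 𝔓 p) (σ : GQ)
    (x : 𝓞 QBar) (hx : (x : QBar) ∈ cyclotomicSubfield p) : σ • x - x ∈ 𝔓 := by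
  have : 𝔓.IsPrime := h𝔓.1
  have hroot : ∀ ξ : 𝓞 QBar, ξ ^ p = 1 → Ideal.Quotient.mk 𝔓 ξ = 1 := by
    intro ξ hξ
    have hchar : CharP (𝓞 QBar ⧸ 𝔓) p := (CharP.charP_iff_prime_eq_zero hp.out).mpr
      (by simpa using Ideal.Quotient.eq_zero_iff_mem.mpr h𝔓.2)
    have h : (Ideal.Quotient.mk 𝔓 ξ - 1) ^ p = 0 := by
      rw [sub_pow_char, ← map_pow, hξ, map_one, one_pow, sub_self]
    exact sub_eq_zero.mp (pow_eq_zero_iff hp.out.ne_zero |>.mp h)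
  obtain ⟨z, hz⟩ : ∃ z : 𝓞 QBar, (z : QBar) = ζ := ⟨⟨ζ, hζ.isIntegral hp.out.pos⟩, rfl⟩
  have hz1 : z ^ p = 1 := NumberField.RingOfIntegers.ext (by simpa [hz] using hζ.pow_eq_one)
  rw [cyclotomicSubfield_eq_adjoin hζ] at hx
  have hgen : IsPrimitiveRoot (AdjoinSimple.gen ℚ ζ) p :=
    IsPrimitiveRoot.of_map_of_injective (f := ℚ⟮ζ⟯.val) (by simpa using hζ) ℚ⟮ζ⟯.val.injective
  have : IsCyclotomicExtension {p} ℚ ℚ⟮ζ⟯ := by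
    convert hζ.intermediateField_adjoin_isCyclotomicExtension ℚ
    · rfl
    · exact Subsingleton.elim _ _
  have hint : IsIntegral ℤ (⟨x, hx⟩ : ℚ⟮ζ⟯) := by
    rw [← isIntegral_algebraMap_iff (B := QBar) (algebraMap ℚ⟮ζ⟯ QBar).injective]
    exact x.isIntegral_coe
  obtain ⟨P, hP⟩ := exists_eval₂_eq_of_isIntegral hgen hint
  have hPx : P.eval₂ (Int.castRingHom (𝓞 QBar)) z = x := by
    apply NumberField.RingOfIntegers.ext
    have h1 := (map_eval₂_intCastRingHom (algebraMap ℚ⟮ζ⟯ QBar) P _).symm.trans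
      (congrArg (algebraMap ℚ⟮ζ⟯ QBar) hP)
    refine (map_eval₂_intCastRingHom (algebraMap (𝓞 QBar) QBar) P z).trans ?_
    exact (congrArg (fun t ↦ P.eval₂ (Int.castRingHom QBar) t) hz).trans h1
  have hσx : P.eval₂ (Int.castRingHom (𝓞 QBar)) (σ • z) = σ • x :=
    (map_eval₂_intCastRingHom (MulSemiringAction.toRingHom GQ (𝓞 QBar) σ) P z).symm.trans
      (congrArg (σ • ·) hPx)
  have hσz : (σ • z) ^ p = 1 := by rw [← smul_pow', hz1, smul_one]
  rw [← Ideal.Quotient.eq, ← hσx, ← hPx, map_eval₂_intCastRingHom, map_eval₂_intCastRingHom,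
    hroot z hz1, hroot _ hσz]

theorem mem_fixingSubgroup_cyclotomicSubfield_iff (σ : GQ) :
    σ ∈ (cyclotomicSubfield p).fixingSubgroup ↔ σ ζ = ζ := by
  rw [cyclotomicSubfield_eq_adjoin hζ, mem_fixingSubgroup_adjoin_iff]

/-- If `σζ ≠ ζ`, dividing `(σζ)^p - ζ^p = 0` by `σζ - ζ` leaves a sum congruent to `p ζ^(p-1)`
modulo `𝔓`; hence `p ∈ 𝔓`, contradicting `ℓ ≠ p`. -/
theorem mem_fixingSubgroup_cyclotomicSubfield_of_mem_inertia {ℓ : ℕ} (hℓ : ℓ.Prime) (hne : ℓ ≠ p)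
    {𝔓 : Ideal (𝓞 QBar)} (h𝔓 : LiesAbove 𝔓 ℓ) {σ : GQ} (hσ : σ ∈ 𝔓.inertia GQ) :
    σ ∈ (cyclotomicSubfield p).fixingSubgroup := by
  have : 𝔓.IsPrime := h𝔓.1
  rw [mem_fixingSubgroup_cyclotomicSubfield_iff hζ]
  by_contra hne'
  obtain ⟨z, hz⟩ : ∃ z : 𝓞 QBar, (z : QBar) = ζ := ⟨⟨ζ, hζ.isIntegral hp.out.pos⟩, rfl⟩
  have hz1 : z ^ p = 1 := NumberField.RingOfIntegers.ext (by simpa [hz] using hζ.pow_eq_one)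
  have hsum := geom_sum₂_mul (σ • z) z p
  rw [← smul_pow', hz1, smul_one, sub_self, mul_eq_zero] at hsum
  have hsum' := hsum.resolve_right (fun h ↦ hne' (by
    rw [← hz, ← coe_smul_integer, sub_eq_zero.mp h]))
  have hmod : Ideal.Quotient.mk 𝔓 (σ • z) = Ideal.Quotient.mk 𝔓 z := Ideal.Quotient.eq.mpr (hσ z)
  have h0 := congrArg (Ideal.Quotient.mk 𝔓) hsum'
  simp only [map_sum, map_mul, map_pow, hmod, map_zero] at h0
  rw [geom_sum₂_self, ← map_pow, ← map_natCast (Ideal.Quotient.mk 𝔓), ← map_mul,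
    Ideal.Quotient.eq_zero_iff_mem] at h0
  have hp𝔓 : (p : 𝓞 QBar) ∈ 𝔓 := by
    have h1 := Ideal.mul_mem_right z 𝔓 h0
    rwa [mul_assoc, ← pow_succ, Nat.sub_add_cancel hp.out.one_le, hz1, mul_one] at h1
  have h2 : (ℓ : ℤ) ∣ (p : ℤ) := by
    rw [← h𝔓.intCast_mem_iff hℓ]
    exact_mod_cast hp𝔓
  exact hne ((Nat.prime_dvd_prime_iff_eq hℓ hp.out).mp (by exact_mod_cast h2))

theorem apply_mul_self_eq_one_of_norm_lt_one {σ : GQ} (h : ‖cyclo p σ + 1‖ < 1) : σ ζ * ζ = 1 := by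
  set χ : ℤ_[p] := ((cyclotomicCharacter QBar p σ.toRingEquiv : ℤ_[p]ˣ) : ℤ_[p]) with hχ
  have h1 : ‖χ + 1‖ < 1 := by
    rw [PadicInt.norm_def]
    rw [cyclo, ← map_one (algebraMap ℚ_[p] (PadicAlgCl p)), ← map_add,
      norm_algebraMap'] at h
    simpa using h
  rw [PadicInt.norm_lt_one_iff_dvd] at h1
  have h2 : PadicInt.toZModPow 1 (χ + 1) = 0 := by
    rw [← RingHom.mem_ker, PadicInt.ker_toZModPow, pow_one, Ideal.mem_span_singleton]
    exact h1
  have h3 := cyclotomicCharacter.spec p (n := 1) σ.toRingEquiv ζ (by simpa using hζ.pow_eq_one)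
  rw [← hχ] at h3
  change σ ζ = _ at h3
  rw [h3, ← pow_succ]
  rw [map_add, map_one] at h2
  have h4 : (p : ℕ) ∣ (PadicInt.toZModPow 1 χ).val + 1 := by
    have : (((PadicInt.toZModPow 1 χ).val + 1 : ℕ) : ZMod (p ^ 1)) = 0 := by
      rw [Nat.cast_add, ZMod.natCast_zmod_val, Nat.cast_one, h2]
    exact (pow_one p).symm.dvd.trans ((ZMod.natCast_eq_zero_iff _ _).mp this)
  exact (hζ.pow_eq_one_iff_dvd _).mpr h4

theorem exists_apply_eq_pow {k : ℕ} (hk : k.Coprime p) : ∃ σ : GQ, σ ζ = ζ ^ k := by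
  have h : IsConjRoot ℚ ζ (ζ ^ k) := by
    rw [isConjRoot_def, ← Polynomial.cyclotomic_eq_minpoly_rat hζ hp.out.pos,
      ← Polynomial.cyclotomic_eq_minpoly_rat (hζ.pow_of_coprime k hk) hp.out.pos]
  obtain ⟨σ, hσ⟩ := isConjRoot_iff_exists_algEquiv.mp h.symm
  exact ⟨σ, hσ⟩

/-- At a prime above `p ≥ 5`, inertia contains an element that generates `Gal(ℚ(ζ_p)/ℚ)` and is
not congruent to `-1`. -/
theorem exists_inertia_generator (hp5 : 5 ≤ p) {𝔓 : Ideal (𝓞 QBar)} (h𝔓 : LiesAbove 𝔓 p) :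
    ∃ σ ∈ 𝔓.inertia GQ, ¬ ‖cyclo p σ + 1‖ < 1 ∧
      ∀ τ : GQ, ∃ n : ℕ, ∃ h ∈ (cyclotomicSubfield p).fixingSubgroup, τ = σ ^ n * h := by
  have : 𝔓.IsPrime := h𝔓.1
  obtain ⟨u, hu⟩ := IsCyclic.exists_monoid_generator (α := (ZMod p)ˣ)
  obtain ⟨σ', hσ'⟩ := exists_apply_eq_pow hζ (ZMod.val_coe_unit_coprime u)
  obtain ⟨γ, hγ, hσ⟩ := exists_mul_mem_inertia 𝔓 (cyclotomicSubfield p)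
    (apply_primitiveRoot_sub_mem hζ h𝔓) σ'
  rw [mem_fixingSubgroup_cyclotomicSubfield_iff hζ] at hγ
  set σ := γ * σ' with hdef
  have hσζ : σ ζ = ζ ^ (u : ZMod p).val := by rw [hdef, AlgEquiv.mul_apply, hσ', map_pow, hγ]
  have hχ (τ : GQ) : ζ ^ ((hζ.autToPow ℚ τ : (ZMod p)ˣ) : ZMod p).val = τ ζ :=
    hζ.autToPow_spec ℚ τ
  have hχσ : hζ.autToPow ℚ σ = u := by
    have := hχ σ
    rw [hσζ] at this
    exact Units.ext (ZMod.val_injective p (hζ.pow_inj (ZMod.val_lt _) (ZMod.val_lt _) this))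
  refine ⟨σ, hσ, fun hlt ↦ ?_, fun τ ↦ ?_⟩
  -- A character value congruent to `-1` would give `u² = 1`, but `u` has order `p - 1 ≥ 4`.
  · have h1 := apply_mul_self_eq_one_of_norm_lt_one hζ hlt
    rw [hσζ, ← pow_succ, hζ.pow_eq_one_iff_dvd, ← ZMod.natCast_eq_zero_iff] at h1
    rw [Nat.cast_add, ZMod.natCast_zmod_val, Nat.cast_one] at h1
    have h2 : u ^ 2 = 1 := by
      apply Units.ext
      push_cast
      linear_combination (u - 1 : ZMod p) * h1
    have h3 : orderOf u = p - 1 := by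
      rw [orderOf_eq_card_of_forall_mem_powers hu, Nat.card_eq_fintype_card, ZMod.card_units]
    have h4 := Nat.le_of_dvd two_pos (orderOf_dvd_of_pow_eq_one h2)
    omega
  · obtain ⟨n, hn⟩ := Submonoid.mem_powers_iff _ _ |>.mp (hu (hζ.autToPow ℚ τ))
    refine ⟨n, (σ ^ n)⁻¹ * τ, ?_, by group⟩
    rw [mem_fixingSubgroup_cyclotomicSubfield_iff hζ, AlgEquiv.mul_apply, ← hχ τ, ← hn, ← hχσ,
      ← map_pow, hχ]
    exact (σ ^ n).symm_apply_apply ζ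

end Cyclotomic

/-! ### Irreducibility over `ℚ(ζ_p)` in the ordinary case -/

section Ordinary

/-- If `r` is irreducible and `σ` generates `G_ℚ` modulo the normal subgroup `G_L`, while
`r σ` satisfies `(X - w) (X - 1) = 0` with `w ≠ -1`, then `r` is irreducible on `G_L`. -/
theorem IrreducibleOver.of_generator {k : Type*} [Field k] {r : GQ →* GL (Fin 2) k}
    (h : IrreducibleOver r ⊥) {L : IntermediateField ℚ QBar} [L.fixingSubgroup.Normal] {σ : GQ}
    (hgen : ∀ τ : GQ, ∃ n : ℕ, ∃ g ∈ L.fixingSubgroup, τ = σ ^ n * g) {w : k} (hw : w + 1 ≠ 0)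
    (hσ : ∀ v, (r σ : Matrix (Fin 2) (Fin 2) k).mulVec ((r σ : Matrix (Fin 2) (Fin 2) k).mulVec v) =
      (w + 1) • (r σ : Matrix (Fin 2) (Fin 2) k).mulVec v - w • v) :
    IrreducibleOver r L := by
  rw [irreducibleOver_iff] at h ⊢
  let R : GQ → (Fin 2 → k) →ₗ[k] (Fin 2 → k) := fun τ ↦ (r τ : Matrix (Fin 2) (Fin 2) k).mulVecLin
  have hR (τ v) : (r τ : Matrix (Fin 2) (Fin 2) k).mulVec v = R τ v := rfl
  have hmul (τ γ v) : R (τ * γ) v = R τ (R γ v) := by simp [R]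
  have hone (v) : R 1 v = v := by simp [R]
  have hinj (τ) {v} (hv : R τ v = 0) : v = 0 := by
    rw [← hone v, ← inv_mul_cancel τ, hmul, hv, map_zero]
  simp only [hR] at h hσ ⊢
  have hall : ∀ U : Submodule k (Fin 2 → k), (∀ g ∈ L.fixingSubgroup, ∀ v ∈ U, R g v ∈ U) →
      (∀ v ∈ U, R σ v ∈ U) → U = ⊥ ∨ U = ⊤ := by
    refine fun U hU hUσ ↦ h U fun τ hτ v hv ↦ ?_
    clear hτ
    obtain ⟨n, g, hg, rfl⟩ := hgen τ
    rw [hmul]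
    have hv := hU g hg v hv
    generalize R g v = v at hv
    induction n with
    | zero => simpa [hone] using hv
    | succ n ih => rw [pow_succ', hmul]; exact hUσ _ ih
  intro W hW
  by_contra! hne
  obtain ⟨v, hv, hv0⟩ := W.ne_bot_iff.mp hne.1
  have hW1 : W = Submodule.span k {v} := by
    refine (Submodule.eq_of_le_of_finrank_le
      ((Submodule.span_singleton_le_iff_mem _ _).mpr hv) ?_).symm
    have := Submodule.finrank_lt hne.2
    rw [Module.finrank_fin_fun] at this
    rw [finrank_span_singleton hv0]
    omega
  have hspan (g) (hg : g ∈ L.fixingSubgroup) : ∃ a : k, R g v = a • v := by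
    have := hW g hg v hv
    rw [hW1, Submodule.mem_span_singleton] at this
    exact this.imp fun _ h ↦ h.symm
  by_cases hσv : R σ v ∈ W
  · rcases hall W hW (fun u hu ↦ by
      rw [hW1, Submodule.mem_span_singleton] at hu
      obtain ⟨a, rfl⟩ := hu
      rw [map_smul]
      exact W.smul_mem _ hσv) with h | h
    · exact hne.1 h
    · exact hne.2 h
  · have hli (a b : k) (hab : a • R σ v = b • v) : a = 0 := by
      by_contra ha
      apply hσv
      rw [← inv_smul_smul₀ ha (R σ v), hab]
      exact W.smul_mem _ (W.smul_mem _ hv)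
    have hli' (a b : k) (hab : a • R σ v = b • v) : b = 0 := by
      rw [hli a b hab, zero_smul] at hab
      exact (smul_eq_zero.mp hab.symm).resolve_right hv0
    -- If `w = 0`, the relation reads `σ²v = σv`, so `σv = v`.
    have hw0 : w ≠ 0 := by
      rintro rfl
      have := hσ v
      rw [zero_add, one_smul, zero_smul, sub_zero] at this
      have : R σ v - v = 0 := hinj σ (by rw [map_sub, this, sub_self])
      exact hσv (by rwa [sub_eq_zero.mp this])
    -- The subgroup is normal, so `v`, `σv` and `σ²v = (w + 1)σv - wv` are all eigenvectors of `g`.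
    -- Both coefficients are nonzero, which forces the three eigenvalues to agree.
    have hscal (g) (hg : g ∈ L.fixingSubgroup) : ∃ a : k, R g v = a • v ∧ R g (R σ v) = a • R σ v := by
      have hconj (τ : GQ) : ∃ a : k, R g (R τ v) = a • R τ v := by
        obtain ⟨a, ha⟩ := hspan (τ⁻¹ * g * τ) (by
          simpa using Subgroup.Normal.conj_mem inferInstance g hg τ⁻¹)
        refine ⟨a, ?_⟩
        rw [← map_smul, ← ha, ← hmul, ← hmul]
        congr 1
        group
      obtain ⟨a, ha⟩ := hspan g hg
      obtain ⟨b, hb⟩ := hconj σ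
      obtain ⟨c, hc⟩ := hconj (σ * σ)
      rw [hmul, hσ, map_sub, map_smul, map_smul, ha, hb] at hc
      have h1 : ((w + 1) * (b - c)) • R σ v = (w * (a - c)) • v := by
        rw [← sub_eq_zero] at hc ⊢
        rw [← hc]
        module
      have h2 := (mul_eq_zero.mp (hli _ _ h1)).resolve_left hw
      have h3 := (mul_eq_zero.mp (hli' _ _ h1)).resolve_left hw0
      refine ⟨a, ha, ?_⟩
      rw [hb, sub_eq_zero.mp h2, sub_eq_zero.mp h3]
    have hu0 : R σ v - v ≠ 0 := fun h ↦ hσv (by rwa [sub_eq_zero.mp h])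
    -- By the quadratic relation `σv - v` is an eigenvector of `σ` with eigenvalue `w`, so its span
    -- is a line stable under `G_ℚ`.
    rcases hall (Submodule.span k {R σ v - v}) (fun g hg u hu ↦ by
        obtain ⟨a, rfl⟩ := Submodule.mem_span_singleton.mp hu
        obtain ⟨b, hb, hb'⟩ := hscal g hg
        rw [map_smul, map_sub, hb, hb', ← smul_sub]
        exact Submodule.smul_mem _ _ (Submodule.smul_mem _ _ (Submodule.mem_span_singleton_self _)))
      (fun u hu ↦ by
        obtain ⟨a, rfl⟩ := Submodule.mem_span_singleton.mp hu
        rw [map_smul, map_sub, hσ, show (w + 1) • R σ v - w • v - R σ v = w • (R σ v - v) by module]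
        exact Submodule.smul_mem _ _ (Submodule.smul_mem _ _ (Submodule.mem_span_singleton_self _)))
      with h | h
    · exact hu0 (Submodule.span_singleton_eq_bot.mp h)
    · have := finrank_span_singleton (K := k) hu0
      rw [h, finrank_top, Module.finrank_fin_fun] at this
      omega

variable {p : ℕ} [hp : Fact p.Prime]

theorem norm_cyclo_le_one (σ : GQ) : ‖cyclo p σ‖ ≤ 1 := by
  rw [cyclo, norm_algebraMap']
  exact PadicInt.norm_le_one _

/-- `σ - 1` maps `V` into `Fil⁺`, where `σ` acts through the cyclotomic character. Stated as a
quadratic relation, ordinarity reduces modulo the maximal ideal without any reduction of `Fil⁺`. -/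
theorem IsOrdinary.act_act {ρ : GQ →* GL (Fin 2) (ZBar p)} (hord : IsOrdinary ρ) :
    ∃ 𝔓 : Ideal (𝓞 QBar), LiesAbove 𝔓 p ∧ ∀ σ ∈ 𝔓.inertia GQ, ∀ v,
      act ρ σ (act ρ σ v) = (cyclo p σ + 1) • act ρ σ v - cyclo p σ • v := by
  obtain ⟨𝔓, h𝔓, Fil, -, -, h1, h2⟩ := hord
  refine ⟨𝔓, h𝔓, fun σ hσ v ↦ ?_⟩
  have h3 := h1 σ hσ _ (h2 σ hσ v)
  rw [act, Matrix.mulVec_sub] at h3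
  change act ρ σ (act ρ σ v) - act ρ σ v = _ at h3
  rw [sub_eq_iff_eq_add] at h3
  rw [h3]
  module

theorem residue_ne_zero {x : ZBar p} (hx : ¬ ‖(x : PadicAlgCl p)‖ < 1) :
    IsLocalRing.residue (ZBar p) x ≠ 0 := by
  rw [Ne, IsLocalRing.residue_eq_zero_iff, Valuation.mem_maximalIdeal_iff,
    PadicAlgCl.valuation_def, ← NNReal.coe_lt_coe]
  exact hx

theorem mapMatrix_quadratic {R S : Type*} [CommRing R] [CommRing S] (f : R →+* S)
    (A : Matrix (Fin 2) (Fin 2) R) (χ : R) :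
    f.mapMatrix ((χ + 1) • A - χ • 1) = (f χ + 1) • f.mapMatrix A - f χ • 1 := by
  ext i j
  simp [Matrix.one_apply, apply_ite f]

theorem residual_quadratic {ρ : GQ →* GL (Fin 2) (ZBar p)} {σ : GQ}
    (h : ∀ v, act ρ σ (act ρ σ v) = (cyclo p σ + 1) • act ρ σ v - cyclo p σ • v)
    (hne : ¬ ‖cyclo p σ + 1‖ < 1) : ∃ w : FBar p, w + 1 ≠ 0 ∧ ∀ v,
      (residual ρ σ : Matrix (Fin 2) (Fin 2) (FBar p)).mulVec
        ((residual ρ σ : Matrix (Fin 2) (Fin 2) (FBar p)).mulVec v) =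
      (w + 1) • (residual ρ σ : Matrix (Fin 2) (Fin 2) (FBar p)).mulVec v - w • v := by
  let χ : ZBar p := ⟨cyclo p σ, norm_cyclo_le_one σ⟩
  set A : Matrix (Fin 2) (Fin 2) (ZBar p) := (ρ σ).val with hA
  have hA2 : A * A = (χ + 1) • A - χ • (1 : Matrix (Fin 2) (Fin 2) (ZBar p)) := by
    apply Matrix.map_injective (ZBar p).subtype_injective
    refine Eq.trans ?_ (mapMatrix_quadratic (ZBar p).subtype A χ).symm
    refine (map_mul (ZBar p).subtype.mapMatrix A A).trans ?_
    apply Matrix.mulVec_injective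
    ext1 v
    rw [← Matrix.mulVec_mulVec, Matrix.sub_mulVec, Matrix.smul_mulVec, Matrix.smul_mulVec,
      Matrix.one_mulVec]
    exact h v
  refine ⟨IsLocalRing.residue (ZBar p) χ, ?_, fun v ↦ ?_⟩
  · rw [← map_one (IsLocalRing.residue (ZBar p)), ← map_add]
    exact residue_ne_zero (x := χ + 1) hne
  · have := congrArg (IsLocalRing.residue (ZBar p)).mapMatrix hA2
    rw [mapMatrix_quadratic, map_mul] at this
    have := congrArg (fun M ↦ M.mulVec v) this
    simp only [← Matrix.mulVec_mulVec, Matrix.sub_mulVec, Matrix.smul_mulVec,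
      Matrix.one_mulVec] at this
    exact this

theorem IrreducibleOver.cyclotomicSubfield (hp5 : 5 ≤ p) {ρ : GQ →* GL (Fin 2) (ZBar p)}
    (hord : IsOrdinary ρ) (h : IrreducibleOver (residual ρ) ⊥) :
    IrreducibleOver (residual ρ) (cyclotomicSubfield p) := by
  obtain ⟨𝔓, h𝔓, hact⟩ := hord.act_act
  obtain ⟨ζ, hζ⟩ := HasEnoughRootsOfUnity.exists_primitiveRoot QBar p
  obtain ⟨σ, hσ, hne, hgen⟩ := exists_inertia_generator hζ hp5 h𝔓
  obtain ⟨w, hw, hquad⟩ := residual_quadratic (hact σ hσ) hne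
  have : (NewformFields.cyclotomicSubfield p).fixingSubgroup.Normal := by
    refine ⟨fun γ hγ τ ↦ ?_⟩
    rw [mem_fixingSubgroup_cyclotomicSubfield_iff hζ]
    have hmem : τ⁻¹ ζ ∈ NewformFields.cyclotomicSubfield p :=
      IntermediateField.subset_adjoin _ _ (hζ.map_of_injective (τ⁻¹).injective)
    have : γ (τ⁻¹ ζ) = τ⁻¹ ζ := hγ ⟨_, hmem⟩
    rw [AlgEquiv.mul_apply, AlgEquiv.mul_apply, this]
    exact τ.apply_symm_apply ζ
  exact h.of_generator hgen hw hquad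

end Ordinary

/-! ### Primes in arithmetic progressions -/

section PrimeChoice

theorem exists_prime_eq_neg_one_mod {M : ℕ} (hM : M ≠ 0) :
    ∃ q : ℕ, q.Prime ∧ 3 < q ∧ (M : ℤ) ∣ q + 1 := by
  have h : IsCoprime (-1 : ℤ) M := isCoprime_one_left.neg_left
  obtain ⟨q, hq, hqp, hmod⟩ := Nat.forall_exists_prime_gt_and_zmodEq 3 hM h
  exact ⟨q, hqp, hq, by simpa using hmod.symm.dvd⟩

theorem exists_nonresidue {ℓ : ℕ} (hℓ : ℓ.Prime) (h2 : ℓ ≠ 2) :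
    ∃ n : ℕ, n.Coprime ℓ ∧ ∀ s : ℤ, ¬ (ℓ : ℤ) ∣ s ^ 2 - n := by
  have := Fact.mk hℓ
  obtain ⟨a, ha⟩ := FiniteField.exists_nonsquare (F := ZMod ℓ) (by rwa [ZMod.ringChar_zmod_n])
  refine ⟨a.val, ?_, fun s hs ↦ ha ⟨s, ?_⟩⟩
  · rw [Nat.coprime_comm, hℓ.coprime_iff_not_dvd, ← ZMod.natCast_eq_zero_iff, ZMod.natCast_zmod_val]
    rintro rfl
    exact ha (IsSquare.zero)
  · rw [← ZMod.intCast_zmod_eq_zero_iff_dvd] at hs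
    push_cast at hs
    rw [ZMod.natCast_zmod_val, sub_eq_zero] at hs
    rw [← hs, pow_two]

/-- There is a prime `q' ≡ 1 mod 8` that is, for each odd prime `ℓ ∣ M`, a nonresidue modulo `ℓ`
if `ℓ` satisfies `P`, and congruent to `1` modulo `ℓ` otherwise. -/
theorem exists_prime_prescribed {M : ℕ} (hM : M ≠ 0) (P : ℕ → Prop) :
    ∃ q : ℕ, q.Prime ∧ ¬ q ∣ M ∧ (8 : ℤ) ∣ q - 1 ∧ ∀ ℓ : ℕ, ℓ.Prime → ℓ ≠ 2 → ℓ ∣ M →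
      (P ℓ → ∀ s : ℤ, ¬ (ℓ : ℤ) ∣ s ^ 2 - q) ∧ (¬ P ℓ → (ℓ : ℤ) ∣ q - 1) := by
  classical
  have hn : ∀ ℓ : ℕ, ∃ n : ℕ, ℓ.Prime → ℓ ≠ 2 → n.Coprime ℓ ∧ ∀ s : ℤ, ¬ (ℓ : ℤ) ∣ s ^ 2 - n := by
    intro ℓ
    by_cases h : ℓ.Prime ∧ ℓ ≠ 2
    · exact (exists_nonresidue h.1 h.2).imp fun _ h _ _ ↦ h
    · exact ⟨0, fun h1 h2 ↦ absurd ⟨h1, h2⟩ h⟩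
  choose n hn using hn
  -- At `2` the modulus is `8`; the factor `2` in `S` imposes this condition even when `M` is odd.
  let m : ℕ → ℕ := fun ℓ ↦ if ℓ = 2 then 8 else ℓ
  let a : ℕ → ℕ := fun ℓ ↦ if ℓ = 2 then 1 else if P ℓ then n ℓ else 1
  let S := (2 * M).primeFactors
  have hS : ∀ ℓ ∈ S, ℓ.Prime := fun ℓ h ↦ Nat.prime_of_mem_primeFactors h
  have hm0 : ∀ ℓ ∈ S, m ℓ ≠ 0 := by
    intro ℓ h
    have := (hS ℓ h).ne_zero
    simp only [m]
    split_ifs <;> simp [this]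
  have hcop : Set.Pairwise (S : Set ℕ) (Function.onFun Nat.Coprime m) := by
    intro i hi j hj hij
    have h : i.Coprime j := (Nat.coprime_primes (hS i hi) (hS j hj)).mpr hij
    simp only [Function.onFun, m]
    split_ifs with h1 h2 h2
    · exact absurd (h1.trans h2.symm) hij
    · subst h1; exact h.pow_left 3
    · subst h2; exact h.pow_right 3
    · exact h
  obtain ⟨x, hx⟩ := Nat.chineseRemainderOfFinset a m S hm0 hcop
  have hxc : ∀ ℓ ∈ S, x.Coprime (m ℓ) := by
    intro ℓ hℓ
    have h : (a ℓ).Coprime (m ℓ) := by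
      simp only [a, m]
      split_ifs with h1 h2
      · simp
      · exact (hn ℓ (hS ℓ hℓ) h1).1
      · simp
    rw [Nat.Coprime, (hx ℓ hℓ).gcd_eq]
    exact h
  obtain ⟨q, hqM, hq, hqx⟩ := Nat.forall_exists_prime_gt_and_modEq M
    (Finset.prod_ne_zero_iff.mpr hm0) (Nat.Coprime.prod_right hxc)
  have hqa : ∀ ℓ ∈ S, (m ℓ : ℤ) ∣ q - a ℓ := fun ℓ hℓ ↦
    (Int.natCast_modEq_iff.mpr
      ((hqx.of_dvd (Finset.dvd_prod_of_mem m hℓ)).trans (hx ℓ hℓ))).symm.dvd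
  refine ⟨q, hq, fun h ↦ ?_, ?_, fun ℓ hℓ h2 hdvd ↦ ?_⟩
  · exact absurd (Nat.le_of_dvd (Nat.pos_of_ne_zero hM) h) (not_le.mpr hqM)
  · have := hqa 2 (by simp [S, hM, Nat.prime_two])
    simpa [m, a] using this
  · have h := hqa ℓ (Nat.mem_primeFactors.mpr ⟨hℓ, Dvd.dvd.mul_left hdvd 2, by positivity⟩)
    simp only [m, a, if_neg h2] at h
    refine ⟨fun hP s hs ↦ ?_, fun hP ↦ by simpa [if_neg hP] using h⟩
    rw [if_pos hP] at h
    exact (hn ℓ hℓ h2).2 s (by simpa using dvd_add hs h)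

end PrimeChoice

/-! ### Construction of `K` and `F` -/

section Assembly

open IntermediateField

theorem splitsIn_adjoin {c : ℤ} (hc : ¬ IsSquare (1 - 4 * c)) {α : QBar} (hα : α ^ 2 - α + c = 0)
    [NumberField ℚ⟮α⟯] {ℓ : ℕ} (hℓ : ℓ.Prime) (s : ℤ) (hs : (ℓ : ℤ) ∣ s ^ 2 - s + c)
    (hs' : ¬ (ℓ : ℤ) ∣ 2 * s - 1) : SplitsIn ℓ ℚ⟮α⟯ := by
  obtain ⟨a, ha⟩ := exists_integer_root hα
  exact splitsIn_of_root (finrank_adjoin_quadratic_root hc hα) hc ha hℓ s hs hs'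

theorem splitsIn_adjoin_of_dvd {c : ℤ} (hc : ¬ IsSquare (1 - 4 * c)) {α : QBar}
    (hα : α ^ 2 - α + c = 0) [NumberField ℚ⟮α⟯] {ℓ : ℕ} (hℓ : ℓ.Prime) (h : (ℓ : ℤ) ∣ c) :
    SplitsIn ℓ ℚ⟮α⟯ := by
  refine splitsIn_adjoin hc hα hℓ 0 (by simpa using h) fun h' ↦ ?_
  exact (Nat.prime_iff_prime_int.mp hℓ).not_isUnit (isUnit_of_dvd_one (by simpa using h'))

theorem inertIn_adjoin {c : ℤ} (hc : ¬ IsSquare (1 - 4 * c)) {α : QBar} (hα : α ^ 2 - α + c = 0)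
    [NumberField ℚ⟮α⟯] {ℓ : ℕ} (hℓ : ℓ.Prime) (h : ∀ s : ℤ, ¬ (ℓ : ℤ) ∣ s ^ 2 - (1 - 4 * c)) :
    InertIn ℓ ℚ⟮α⟯ := by
  obtain ⟨a, ha⟩ := exists_integer_root hα
  refine inertIn_of_no_root (finrank_adjoin_quadratic_root hc hα) ha hℓ fun s hs ↦
    h (2 * s - 1) ?_
  rw [show (2 * s - 1) ^ 2 - (1 - 4 * c) = 4 * (s ^ 2 - s + c) by ring]
  exact Dvd.dvd.mul_left hs 4

theorem discr_adjoin_dvd {c : ℤ} (hc : ¬ IsSquare (1 - 4 * c)) {α : QBar} (hα : α ^ 2 - α + c = 0)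
    [NumberField ℚ⟮α⟯] : NumberField.discr ℚ⟮α⟯ ∣ 1 - 4 * c := by
  obtain ⟨a, ha⟩ := exists_integer_root hα
  exact discr_dvd_of_quadratic (finrank_adjoin_quadratic_root hc hα) hc ha

/-- `5` ramifies in `ℚ(ζ₅)⁺`: the element `a = -(ζ + ζ⁻¹)` satisfies `(2a - 1)² = 5`. If `(5)` were
prime, then `5` would divide `2a - 1` and `25` would divide `5`. -/
theorem ne_realCyclotomicSubfield_of_inertIn {F : IntermediateField ℚ QBar} [NumberField F]
    (h : InertIn 5 F) : F ≠ realCyclotomicSubfield 5 := by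
  intro hF
  obtain ⟨ζ, hζ⟩ := HasEnoughRootsOfUnity.exists_primitiveRoot QBar 5
  have hmem : ζ + ζ⁻¹ ∈ F := by
    rw [hF]
    exact subset_adjoin _ _ ⟨ζ, hζ, rfl⟩
  have hsum : ζ ^ 4 + ζ ^ 3 + ζ ^ 2 + ζ + 1 = 0 := by
    have := hζ.geom_sum_eq_zero (by norm_num)
    simp only [Finset.sum_range_succ, Finset.sum_range_zero] at this
    linear_combination this
  have hζ0 : ζ ≠ 0 := hζ.ne_zero (by norm_num)
  have hx : (ζ + ζ⁻¹) ^ 2 - (-1) * (ζ + ζ⁻¹) - 1 = 0 := by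
    field_simp
    linear_combination hsum
  have hx' : (-(ζ + ζ⁻¹)) ^ 2 - (-(ζ + ζ⁻¹)) + (-1 : ℤ) = 0 := by
    push_cast
    linear_combination hx
  have hx'' : (⟨-(ζ + ζ⁻¹), neg_mem hmem⟩ : F) ^ 2 - ⟨-(ζ + ζ⁻¹), neg_mem hmem⟩ + (-1 : ℤ) = 0 :=
    Subtype.ext (by simpa using hx')
  obtain ⟨a, ha⟩ : ∃ a : 𝓞 F, (a : F) = ⟨-(ζ + ζ⁻¹), neg_mem hmem⟩ :=
    ⟨⟨_, isIntegral_root hx''⟩, rfl⟩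
  have ha2 : a ^ 2 - a - 1 = 0 := NumberField.RingOfIntegers.ext (by
    rw [← ha] at hx''
    push_cast at hx''
    rw [← sub_eq_add_neg] at hx''
    exact hx'')
  have hsq : (2 * a - 1) ^ 2 = 5 := by linear_combination 4 * ha2
  have hP : (Ideal.span {((5 : ℕ) : 𝓞 F)}).IsPrime := h
  have h1 : 2 * a - 1 ∈ Ideal.span {((5 : ℕ) : 𝓞 F)} := by
    refine hP.mem_of_pow_mem 2 ?_
    rw [hsq]
    exact Ideal.subset_span (by simp)
  obtain ⟨y, hy⟩ := Ideal.mem_span_singleton'.mp h1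
  refine hP.ne_top ((Ideal.eq_top_iff_one _).mpr (Ideal.mem_span_singleton'.mpr ⟨y ^ 2, ?_⟩))
  have h5 : (5 : 𝓞 F) ≠ 0 := by norm_num
  apply mul_left_cancel₀ h5
  rw [← hy] at hsq
  push_cast at hsq ⊢
  linear_combination hsq

theorem residual_eq_one {N p : ℕ} [Fact p.Prime] {g : CuspForm (G0 N) 2}
    {ι : heckeField g →+* PadicAlgCl p} {ρ : GQ →* GL (Fin 2) (ZBar p)}
    (hρ : IsGaloisRepOf g ι ρ) {q : ℕ} (hq : q.Prime) (hqN : ¬ q ∣ N * p) {𝔓 : Ideal (𝓞 QBar)}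
    (h𝔓 : LiesAbove 𝔓 q) {σ : GQ} (hσ : σ ∈ 𝔓.inertia GQ) : residual ρ σ = 1 := by
  rw [residual, MonoidHom.comp_apply, hρ.unramified q hq hqN 𝔓 h𝔓 σ hσ, map_one]

/-- A root of `X² - X + (1 + q) / 4` modulo `r`, from quadratic reciprocity. -/
theorem exists_root_mod_prime {q r : ℕ} (hq : q.Prime) (hr : r.Prime) (hq2 : q ≠ 2) (hne : r ≠ q)
    (hr8 : (8 : ℤ) ∣ r - 1) (hrq : (q : ℤ) ∣ r - 1) {c : ℤ} (hc : 1 - 4 * c = -q) :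
    ∃ s : ℤ, (r : ℤ) ∣ s ^ 2 - s + c ∧ ¬ (r : ℤ) ∣ 2 * s - 1 := by
  have := Fact.mk hq
  have := Fact.mk hr
  have hr4 : r % 4 = 1 := by omega
  have h1 : IsSquare ((r : ℕ) : ZMod q) := by
    have : ((r - 1 : ℤ) : ZMod q) = 0 := (ZMod.intCast_zmod_eq_zero_iff_dvd _ _).mpr hrq
    push_cast at this
    rw [sub_eq_zero.mp this]
    exact IsSquare.one
  have h2 : IsSquare ((q : ℕ) : ZMod r) := 
    (ZMod.exists_sq_eq_prime_iff_of_mod_four_eq_one hr4 hq2).mpr h1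
  have h3 : IsSquare (-1 : ZMod r) := ZMod.exists_sq_eq_neg_one_iff.mpr (by omega)
  -- `t² = -q` is the discriminant modulo `r`, so `(t + 1)/2` is a root.
  obtain ⟨t, ht⟩ := h3.mul h2
  have hcr : (1 - 4 * c : ZMod r) = -q := by exact_mod_cast congrArg (Int.cast : ℤ → ZMod r) hc
  have h20 : (2 : ZMod r) ≠ 0 := by
    intro h
    have : (r : ℕ) ∣ 2 := (ZMod.natCast_eq_zero_iff _ _).mp (by exact_mod_cast h)
    have := Nat.le_of_dvd two_pos this
    have := hr.two_le
    omega
  obtain ⟨s, hs⟩ := ZMod.intCast_surjective ((t + 1) / 2 : ZMod r)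
  have hs2 : (2 * s - 1 : ZMod r) = t := by
    rw [hs]; field_simp; ring
  refine ⟨s, ?_, fun h ↦ ?_⟩
  · rw [← ZMod.intCast_zmod_eq_zero_iff_dvd]
    push_cast
    have h4 : (2 * 2 : ZMod r) * (s ^ 2 - s + c) = 0 := by
      linear_combination (2 * s - 1 + t : ZMod r) * hs2 - ht - hcr
    exact (mul_eq_zero.mp h4).resolve_left (mul_ne_zero h20 h20)
  · rw [← ZMod.intCast_zmod_eq_zero_iff_dvd] at h
    push_cast at h
    rw [hs2] at h
    rw [h, mul_zero, neg_one_mul, neg_eq_zero, ZMod.natCast_eq_zero_iff] at ht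
    exact hne ((Nat.prime_dvd_prime_iff_eq hr hq).mp ht)

end Assembly

end NewformFields

end

theorem lemma5p4 (N : ℕ) [NeZero N] (g : CuspForm (NewformFields.G0 N) 2)
    (hg : NewformFields.IsNewform g)
    (p : ℕ) [Fact p.Prime] (hp : 5 ≤ p)
    (ι : NewformFields.heckeField g →+* PadicAlgCl p)
    (ρ : NewformFields.GQ →* GL (Fin 2) (NewformFields.ZBar p))
    (hρ : NewformFields.IsGaloisRepOf g ι ρ)
    (hgood : ¬ p ∣ N) (hord : NewformFields.IsOrdinary ρ)
    (hirr : NewformFields.IrreducibleOver (NewformFields.residual ρ) ⊥) :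
    ∃ (K F : IntermediateField ℚ NewformFields.QBar) (_ : NumberField K) (_ : NumberField F),
      NewformFields.ConditionsOnK N p (NewformFields.residual ρ) K ∧
      NewformFields.ConditionsOnF N p (NewformFields.residual ρ) K F := by
  open NewformFields IntermediateField in
  have hp' : p.Prime := Fact.out
  have hN0 : N ≠ 0 := NeZero.ne N
  obtain ⟨q, hq, hq3, hqM⟩ := exists_prime_eq_neg_one_mod (M := 8 * N * p)
    (by simp [hN0, hp'.ne_zero])
  have hqNp : ¬ q ∣ N * p := by
    intro h
    have h1 : (q : ℤ) ∣ q + 1 := by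
      refine dvd_trans ?_ hqM
      rw [mul_assoc]
      exact_mod_cast Dvd.dvd.mul_left h 8
    have h2 : (q : ℤ) ∣ 1 := by simpa using h1
    exact (Nat.prime_iff_prime_int.mp hq).not_isUnit (isUnit_of_dvd_one h2)
  obtain ⟨m, hm⟩ := hqM
  push_cast at hm
  -- `c = (q + 1)/4` is divisible by `N` and by `p`, so `0` is a root of `X² - X + c` modulo each
  -- prime that has to split in `K`.
  obtain ⟨c, hc⟩ : ∃ c : ℤ, c = 2 * N * p * m := ⟨_, rfl⟩
  have hcq : 1 - 4 * c = -q := by rw [hc]; linear_combination hm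
  have hcq' : (1 - 4 * c).natAbs = q := by simp [hcq]
  have hcs := not_isSquare_of_natAbs_prime (d := 1 - 4 * c) (hcq' ▸ hq)
  obtain ⟨α, hα⟩ := exists_quadratic_root c
  have hKnf := numberField_adjoin_quadratic_root hcs hα
  -- The factor `q` in the modulus forces `r ≡ 1 mod q`, as needed for `r` to split in `K`.
  obtain ⟨r, hr, hrM, hr8, hrℓ⟩ := exists_prime_prescribed (M := N * p * q)
    (by simp [hN0, hp'.ne_zero, hq.ne_zero])
    (fun ℓ ↦ ℓ = p ∨ (ℓ ∣ N ∧ (ℓ : ℤ) ≡ -1 [ZMOD p]))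
  have hrNp : ¬ r ∣ N * p := fun h ↦ hrM (Dvd.dvd.mul_right h q)
  have hrq : r ≠ q := by rintro rfl; exact hrM (Dvd.intro_left _ rfl)
  have hrp : r ≠ p := by rintro rfl; exact hrNp (Dvd.intro_left _ rfl)
  have hqp : q ≠ p := by rintro rfl; exact hqNp (Dvd.intro_left _ rfl)
  have hqr : (q : ℤ) ∣ r - 1 := (hrℓ q hq (by omega) (Dvd.intro_left _ rfl)).2 (by
    rintro (h | h)
    · exact hqp h
    · exact hqNp (Dvd.dvd.mul_right h.1 p))
  obtain ⟨e, he⟩ := hr8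
  obtain ⟨d, hd⟩ : ∃ d : ℤ, d = -(2 * e) := ⟨_, rfl⟩
  have hdr : 1 - 4 * d = r := by rw [hd]; linear_combination -he
  have hdr' : (1 - 4 * d).natAbs = r := by simp [hdr]
  have hds := not_isSquare_of_natAbs_prime (d := 1 - 4 * d) (hdr' ▸ hr)
  obtain ⟨β, hβ⟩ := exists_quadratic_root d
  have hFnf := numberField_adjoin_quadratic_root hds hβ
  have hDK : NumberField.discr ℚ⟮α⟯ ∣ (q : ℤ) := by
    simpa [hcq] using discr_adjoin_dvd hcs hα
  have hDF : NumberField.discr ℚ⟮β⟯ ∣ (r : ℤ) := by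
    simpa [hdr] using discr_adjoin_dvd hds hβ
  have hinert {ℓ : ℕ} (hℓ : ℓ.Prime) (h2 : ℓ ≠ 2) (hM : ℓ ∣ N * p * q)
      (hP : ℓ = p ∨ (ℓ ∣ N ∧ (ℓ : ℤ) ≡ -1 [ZMOD p])) : InertIn ℓ ℚ⟮β⟯ :=
    inertIn_adjoin hds hβ hℓ (hdr ▸ (hrℓ ℓ hℓ h2 hM).1 hP)
  have hinert_p : InertIn p ℚ⟮β⟯ :=
    hinert hp' (by omega) ⟨N * q, by ring⟩ (.inl rfl)
  refine ⟨ℚ⟮α⟯, ℚ⟮β⟯, hKnf, hFnf, ⟨?_, ⟨?_, ?_⟩, ?_, ?_, ?_⟩, ⟨?_, ?_, ?_, ?_, ?_, ?_, ?_, ?_, ?_⟩⟩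
  · exact isImaginaryQuadratic_adjoin_quadratic_root hcs hα (by rw [hcq]; have := hq.pos; omega)
  · obtain ⟨x, hx⟩ := hDK
    have hodd : Odd (q : ℤ) := by exact_mod_cast hq.odd_of_ne_two (by omega)
    rw [hx, Int.odd_mul] at hodd
    exact hodd.1
  · intro h
    rw [h, Int.neg_dvd] at hDK
    have : 3 = q := (Nat.prime_dvd_prime_iff_eq Nat.prime_three hq).mp (by exact_mod_cast hDK)
    omega
  · intro ℓ hℓ hℓN
    refine splitsIn_adjoin_of_dvd hcs hα hℓ ?_
    obtain ⟨x, rfl⟩ := hℓN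
    exact ⟨2 * x * p * m, by rw [hc]; push_cast; ring⟩
  · exact splitsIn_adjoin_of_dvd hcs hα hp' ⟨2 * N * m, by rw [hc]; ring⟩
  · rw [← sup_bot_eq ℚ⟮α⟯]
    exact hirr.sup_quadratic hα hq hcq' fun 𝔓 h𝔓 σ hσ ↦
      ⟨residual_eq_one hρ hq hqNp h𝔓 hσ, by simp⟩
  · exact isRealQuadratic_adjoin_quadratic_root hds hβ (by rw [hdr]; exact_mod_cast hr.pos)
  · exact hinert_p
  · obtain ⟨x, hx⟩ := hDF
    have hodd : Odd (r : ℤ) := by exact_mod_cast hr.odd_of_ne_two (by omega)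
    rw [hx, Int.odd_mul] at hodd
    exact hodd.1
  · intro ℓ hℓ hℓD
    obtain rfl : ℓ = r := (Nat.prime_dvd_prime_iff_eq hℓ hr).mp (by exact_mod_cast hℓD.trans hDF)
    obtain ⟨s, hs, hs'⟩ := exists_root_mod_prime hq hr (by omega) hrq ⟨e, he⟩ hqr hcq
    exact splitsIn_adjoin hcs hα hr s hs hs'
  · intro ℓ hℓ hℓN hℓp
    refine hinert hℓ ?_ (Dvd.dvd.mul_right (Dvd.dvd.mul_right hℓN p) q) (.inr ⟨hℓN, hℓp⟩)
    -- The prime `2` never has to be inert: `2 ≡ -1 mod p` would give `p ∣ 3`.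
    rintro rfl
    have h3 : (p : ℤ) ∣ 3 := by simpa using hℓp.symm.dvd
    have := Int.le_of_dvd (by norm_num) h3
    omega
  · intro ℓ hℓ hℓN hℓp
    refine splitsIn_adjoin_of_dvd hds hβ hℓ ?_
    by_cases h2 : ℓ = 2
    · subst h2
      -- `d = (1 - r)/4` is even since `r ≡ 1 mod 8`, so `2` splits in `F`.
      exact ⟨-e, by rw [hd]; push_cast; ring⟩
    · have h := (hrℓ ℓ hℓ h2 (Dvd.dvd.mul_right (Dvd.dvd.mul_right hℓN p) q)).2 (by
        rintro (h | h)
        · exact hgood (h ▸ hℓN)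
        · exact hℓp h.2)
      rw [show (r : ℤ) - 1 = -(2 ^ 2 * d) by rw [← hdr]; ring, dvd_neg] at h
      have hℓ' := Nat.prime_iff_prime_int.mp hℓ
      refine (hℓ'.dvd_or_dvd h).resolve_left fun h ↦ h2 ?_
      exact (Nat.prime_dvd_prime_iff_eq hℓ Nat.prime_two).mp
        (by exact_mod_cast hℓ'.dvd_of_dvd_pow h)
  · have hK : IrreducibleOver (residual ρ) ℚ⟮α⟯ := by
      rw [← sup_bot_eq ℚ⟮α⟯]
      exact hirr.sup_quadratic hα hq hcq' fun 𝔓 h𝔓 σ hσ ↦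
        ⟨residual_eq_one hρ hq hqNp h𝔓 hσ, by simp⟩
    refine hK.sup_quadratic hβ hr hdr' fun 𝔓 h𝔓 σ hσ ↦ ⟨residual_eq_one hρ hr hrNp h𝔓 hσ,
      mem_fixingSubgroup_of_unramified hα hr (fun h ↦ hrq ?_) h𝔓 hσ⟩
    rw [hcq, dvd_neg] at h
    exact (Nat.prime_dvd_prime_iff_eq hr hq).mp (by exact_mod_cast h)
  · obtain ⟨ζ, hζ⟩ := HasEnoughRootsOfUnity.exists_primitiveRoot QBar p
    exact (hirr.cyclotomicSubfield hp hord).sup_quadratic hβ hr hdr' fun 𝔓 h𝔓 σ hσ ↦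
      ⟨residual_eq_one hρ hr hrNp h𝔓 hσ,
        mem_fixingSubgroup_cyclotomicSubfield_of_mem_inertia hζ hr hrp h𝔓 hσ⟩
  · rintro rfl
    exact ne_realCyclotomicSubfield_of_inertIn hinert_p
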